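/- Let $d\ge 1$ be an integer and let $\Delta=-\sum_{j=1}^d\partial_j^2$ on $\mathbb{R}^d$. For $p\in(1,\infty)$ write $p'=p/(p-1)$. For $p\in(1,\infty)$, $\alpha\in[0,d/p)$ and $q\in[p,\infty)$ with $\frac1q=\frac1p-\frac{\alpha}{d}$, let $E(p,q,d)$ and $E_H(p,q,d)$ be the best constants of the embeddings into $L^q(\mathbb{R}^d)$ of, respectively, the inhomogeneous Sobolev space $L^p_\alpha=\{f\in L^p:(I+\Delta)^{\alpha/2}f\in L^p\}$ with norm $\|(I+\Delta)^{\alpha/2}f\|_{L^p}$, and the homogeneous Sobolev space $\dot L^p_\alpha$, the closure of the Schwartz functions with respect to the norm $\|\Delta^{\alpha/2}f\|_{L^p}$. Let $\omega_{d-1}$ be the surface measure of the unit sphere in $\mathbb{R}^d$ and, for $\alpha>0$, put $$ \widetilde E_H(p,q,d)=\frac{1}{2^{\alpha}\pi^{d/2}}\frac{\Gamma((d-\alpha)/2)}{\Gamma(\alpha/2)}\,\frac d\alpha\Big(\frac{\omega_{d-1}}{d}\Big)^{1-\frac\alpha d}\Big(1-\frac\alpha d\Big)^{1-\frac\alpha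 d}\frac{1}{pq'}\Big({p'}^{\frac1{p'}+\frac1q}+q^{\frac1{p'}+\frac1q}\Big), $$ where for $\alpha=0$ the factor $\frac{d}{\alpha\,\Gamma(\alpha/2)}=\frac{d}{2\Gamma(1+\alpha/2)}$ is given its limit value $d/2$. Put $$ F(p,q)=\Big(\frac1{p'}+\frac1q\Big)^{-1}\frac1{pq'}\Big({p'}^{\frac1q}+q^{\frac1{p'}}\Big). $$ Then there exist positive constants $B_1,B_2$ depending only on $d$ such that, for all $p\in(1,\infty)$, $\alpha\in[0,d/p)$ and $q\in[p,\infty)$ with $\frac1q=\frac1p-\frac\alpha d$, $$ E(p,q,d)\le B_1E_H(p,q,d)\le B_1\widetilde E_H(p,q,d) \qquad\text{and}\qquad \frac1{B_2}F(p,q)\le\widetilde E_H(p,q,d)\le B_2F(p,q). $$ -/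

import Mathlib

open MeasureTheory Filter Topology
open scoped SchwartzMap FourierTransform ENNReal

noncomputable section

namespace SobolevConst

/-- The Euclidean space `ℝ^d`. -/
abbrev Euc (d : ℕ) : Type := EuclideanSpace ℝ (Fin d)

/-- The tempered distribution `T` is (integration against) the function `f`. It is only used for
`f` in some `L^r`, `1 ≤ r ≤ ∞`, so that the integral converges absolutely. -/
def Represents {d : ℕ} (T : 𝓢'(Euc d, ℂ)) (f : Euc d → ℂ) : Prop :=
  ∀ φ : 𝓢(Euc d, ℂ), T φ = ∫ x, φ x * f x

/-- The operator `(I + Δ)^{α/2}` on tempered distributions, where `Δ = -∑ ∂_j²` is the positive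
Laplacian: with `𝓕 u ξ = ∫ e^{-2πi x·ξ} u x dx` it is the Fourier multiplier
`(1 + (2π|ξ|)²)^{α/2}`. -/
def besselOp (d : ℕ) (α : ℝ) : 𝓢'(Euc d, ℂ) →L[ℂ] 𝓢'(Euc d, ℂ) :=
  TemperedDistribution.fourierMultiplierCLM ℂ
    (fun ξ : Euc d => (((1 + (2 * Real.pi * ‖ξ‖) ^ 2) ^ (α / 2) : ℝ) : ℂ))

/-- The symbol of `(I + Δ)^{α/2}` is an admissible multiplier on tempered distributions. -/
theorem hasTemperateGrowth_besselSymbol (d : ℕ) (α : ℝ) :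
    (fun ξ : Euc d => (((1 + (2 * Real.pi * ‖ξ‖) ^ 2) ^ (α / 2) : ℝ) : ℂ)).HasTemperateGrowth := by
  have h := (Function.hasTemperateGrowth_one_add_norm_sq_rpow (Euc d) (α / 2)).comp
    (((2 * Real.pi) • ContinuousLinearMap.id ℝ (Euc d)).hasTemperateGrowth)
  have h' : (fun ξ : Euc d => (1 + (2 * Real.pi * ‖ξ‖) ^ 2) ^ (α / 2)).HasTemperateGrowth := by
    refine (congrArg Function.HasTemperateGrowth (funext fun ξ => ?_)).mp h
    simp [norm_smul, abs_of_pos Real.pi_pos]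
  exact (Complex.ofRealCLM.hasTemperateGrowth).comp h'

/-- `Δ^{α/2} φ` for a Schwartz function `φ`: the inverse Fourier transform of the integrable
function `(2π|ξ|)^α 𝓕 φ ξ`. -/
def fracLaplacian {d : ℕ} (α : ℝ) (φ : 𝓢(Euc d, ℂ)) : Euc d → ℂ :=
  𝓕⁻ (fun ξ : Euc d => (((2 * Real.pi * ‖ξ‖) ^ α : ℝ) : ℂ) * 𝓕 (φ : Euc d → ℂ) ξ)

/-- `T` belongs to the inhomogeneous space `L^p_α`, that is, `T` and `(I + Δ)^{α/2} T` are both in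
`L^p`, and its norm `‖(I + Δ)^{α/2} T‖_{L^p}` is `N`. -/
def InhomSobolevNorm {d : ℕ} (p α : ℝ) (T : 𝓢'(Euc d, ℂ)) (N : ℝ≥0∞) : Prop :=
  ∃ f g : Euc d → ℂ, MemLp f (ENNReal.ofReal p) ∧ Represents T f ∧
    MemLp g (ENNReal.ofReal p) ∧ Represents (besselOp d α T) g ∧
    N = eLpNorm g (ENNReal.ofReal p)

/-- `T` belongs to the homogeneous space, the closure of the Schwartz functions with respect to
`φ ↦ ‖Δ^{α/2} φ‖_{L^p}`, and its norm is `N`: there are Schwartz functions `φ n` converging to `T`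
as tempered distributions such that `Δ^{α/2} (φ n)` converges in `L^p` to some `g`, and
`N = ‖g‖_{L^p}`. -/
def HomSobolevNorm {d : ℕ} (p α : ℝ) (T : 𝓢'(Euc d, ℂ)) (N : ℝ≥0∞) : Prop :=
  ∃ (φ : ℕ → 𝓢(Euc d, ℂ)) (g : Euc d → ℂ), MemLp g (ENNReal.ofReal p) ∧
    Tendsto (fun n => SchwartzMap.toTemperedDistributionCLM (Euc d) ℂ volume (φ n))
      atTop (𝓝 T) ∧
    Tendsto (fun n => eLpNorm (fracLaplacian α (φ n) - g) (ENNReal.ofReal p)) atTop (𝓝 0) ∧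
    N = eLpNorm g (ENNReal.ofReal p)

/-- The best constant in the embedding into `L^q` of a space `X` of tempered distributions
(`X T N` says that `T` is in the space and has norm `N`): the infimum of the `C` such that every
element `T` of the space is a function in `L^q` with `‖T‖_{L^q} ≤ C N`. It is `∞` if there is no
such finite `C`. -/
def bestEmbeddingConst {d : ℕ} (X : 𝓢'(Euc d, ℂ) → ℝ≥0∞ → Prop) (q : ℝ) : ℝ≥0∞ :=
  sInf {C : ℝ≥0∞ | ∀ T N, X T N → ∃ f : Euc d → ℂ,
    MemLp f (ENNReal.ofReal q) ∧ Represents T f ∧ eLpNorm f (ENNReal.ofReal q) ≤ C * N}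

/-- The order `α` determined by `1/q = 1/p - α/d`. -/
def order (p q : ℝ) (d : ℕ) : ℝ := d * (1 / p - 1 / q)

/-- `E(p,q,d)`, the best constant of the inhomogeneous Sobolev embedding. -/
def E (p q : ℝ) (d : ℕ) : ℝ≥0∞ :=
  bestEmbeddingConst (InhomSobolevNorm (d := d) p (order p q d)) q

/-- `E_H(p,q,d)`, the best constant of the homogeneous Sobolev embedding. -/
def EH (p q : ℝ) (d : ℕ) : ℝ≥0∞ :=
  bestEmbeddingConst (HomSobolevNorm (d := d) p (order p q d)) q

/-- The surface measure `ω_{d-1}` of the unit sphere of `ℝ^d`. -/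
def sphereArea (d : ℕ) : ℝ := (volume : Measure (Euc d)).toSphere.real Set.univ

/-- The constant of the Riesz potential: `Δ^{-α/2} f = rieszConst d α • (|x|^{α-d} * f)`,
for `0 < α < d`. -/
def rieszConst (d : ℕ) (α : ℝ) : ℝ :=
  1 / (2 ^ α * Real.pi ^ ((d : ℝ) / 2)) * (Real.Gamma ((d - α) / 2) / Real.Gamma (α / 2))

/-- Lieb's upper bound for the best constant of the Hardy-Littlewood-Sobolev inequality,
for `0 < α < d` and `1/q = 1/p - α/d`. -/
def liebBound (p q : ℝ) (d : ℕ) (α : ℝ) : ℝ :=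
  d / α * (sphereArea d / d) ^ (1 - α / d) * (1 - α / d) ^ (1 - α / d) *
    (1 / (p * q.conjExponent)) *
    (p.conjExponent ^ (1 / p.conjExponent + 1 / q) + q ^ (1 / p.conjExponent + 1 / q))

/-- `Ẽ_H(p,q,d)`, the explicit upper bound for `E_H(p,q,d)`: for `α > 0` it is the product of the
constant of the Riesz potential and Lieb's bound (`EHtilde_eq`). It is written here with
`(d/α) / Γ(α/2) = (d/2) / Γ(1 + α/2)`, which also gives the limit value at `α = 0`. -/
def EHtilde (p q : ℝ) (d : ℕ) : ℝ :=
  let α := order p q d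
  1 / (2 ^ α * Real.pi ^ ((d : ℝ) / 2)) *
    (Real.Gamma ((d - α) / 2) / Real.Gamma (1 + α / 2)) * (d / 2) *
    (sphereArea d / d) ^ (1 - α / d) * (1 - α / d) ^ (1 - α / d) *
    (1 / (p * q.conjExponent)) *
    (p.conjExponent ^ (1 / p.conjExponent + 1 / q) + q ^ (1 / p.conjExponent + 1 / q))

theorem EHtilde_eq (p q : ℝ) (d : ℕ) (h : 0 < order p q d) :
    EHtilde p q d = rieszConst d (order p q d) * liebBound p q d (order p q d) := by
  have h2 : order p q d / 2 ≠ 0 := by positivity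
  have hG : Real.Gamma (order p q d / 2) ≠ 0 := (Real.Gamma_pos_of_pos (by positivity)).ne'
  have e : Real.Gamma (1 + order p q d / 2) = order p q d / 2 * Real.Gamma (order p q d / 2) := by
    rw [add_comm, Real.Gamma_add_one h2]
  simp only [EHtilde, rieszConst, liebBound, e]
  field_simp

/-- `F(p,q) = (1/p' + 1/q)⁻¹ (p q')⁻¹ (p'^{1/q} + q^{1/p'})`. -/
def F (p q : ℝ) : ℝ :=
  1 / (1 / p.conjExponent + 1 / q) * (1 / (p * q.conjExponent)) *
    (p.conjExponent ^ (1 / q) + q ^ (1 / p.conjExponent))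

end SobolevConst

end

open MeasureTheory Filter Topology
open scoped SchwartzMap FourierTransform ENNReal

noncomputable section

namespace SobolevConst

/-! ### The explicit constant -/

/-! Throughout, `s = 1 - α/d = 1/p' + 1/q`.

Comparison of `EHtilde` with `F`: the factor Γ((d-α)/2) = Γ(ds/2) has a pole at `s = 0`, which
accounts for the factor 1/s in `F`. What is left of the Gamma factors and powers is continuous and
positive on [0,1], hence bounded above and below (`exists_bounds_boundedFactor`). The quantities
s^s, p'^{1/p'} and q^{1/q} lie between 1/e and e, so p'^s and q^s may be replaced by p'^{1/q} and
q^{1/p'} (`exists_EHtilde_bounds`).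

Homogeneous embedding: for α > 0, writing λ^{-α/2} as a superposition of the exponentials e^{-tλ}
shows that a Schwartz function φ is dominated by the Riesz potential of |Δ^{α/2} φ|
(`enorm_le_riesz_fracLaplacian`). Pairing with |φ|^{q-1} and applying the Hardy-Littlewood-Sobolev
inequality gives the constant `EHtilde` (`eLpNorm_le_EHtilde`). Lieb's constant in that inequality
comes from the layer cake formula: two superlevel sets interact at most as min(|A||B|^{α/d},
|B||A|^{α/d}), and the quarter plane of levels is cut along a power curve. For α = 0 the constant is
1. Limits of Schwartz functions inherit the bound (`EH_le_EHtilde`).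

Inhomogeneous against homogeneous: Δ^{α/2}(I+Δ)^{-α/2} = (I-R)^{α/2} with R = (I+Δ)⁻¹. The resolvent
R is an average of translations, hence a contraction of every L^p, and for 0 ≤ s ≤ 1 the Taylor
coefficients of (1-y)^s have absolute sum at most 2. So (I-R)^{α/2} has norm at most 2^{d+1}
(`eLpNorm_ratioOp_le`), uniformly in p, q and α, where a Calderón-Zygmund multiplier theorem would
give a constant that blows up as p tends to 1 or ∞. -/

theorem sphereArea_div (d : ℕ) (hd : 1 ≤ d) :
    sphereArea d / d = (volume : Measure (Euc d)).real (Metric.ball 0 1) := by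
  have : (d : ℝ) ≠ 0 := by positivity
  rw [sphereArea, Measure.toSphere_real_apply_univ]
  simp [this]

theorem sphereArea_div_pos (d : ℕ) (hd : 1 ≤ d) : 0 < sphereArea d / d := by
  rw [sphereArea_div d hd]
  exact ENNReal.toReal_pos (Metric.measure_ball_pos _ _ one_pos).ne' measure_ball_lt_top.ne

theorem sphereArea_div_eq (d : ℕ) (hd : 1 ≤ d) :
    sphereArea d / d = Real.pi ^ ((d : ℝ) / 2) / Real.Gamma (d / 2 + 1) := by
  have : Nonempty (Fin d) := ⟨⟨0, hd⟩⟩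
  have hG : 0 < Real.Gamma ((d : ℝ) / 2 + 1) := Real.Gamma_pos_of_pos (by positivity)
  rw [sphereArea_div d hd, measureReal_def, EuclideanSpace.volume_ball]
  have : √Real.pi ^ d = Real.pi ^ ((d : ℝ) / 2) := by
    rw [Real.sqrt_eq_rpow, ← Real.rpow_natCast, ← Real.rpow_mul Real.pi_pos.le]
    congr 1; ring
  simp only [Fintype.card_fin, ENNReal.ofReal_one, one_pow, one_mul, this]
  rw [ENNReal.toReal_ofReal (by positivity)]

/-- The exponents of the embedding `L^p_α ⊂ L^q` and the relations between them. -/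
structure Exponents (d : ℕ) (p q α : ℝ) : Prop where
  one_le_dim : 1 ≤ d
  one_lt_p : 1 < p
  nonneg_order : 0 ≤ α
  order_lt : α < d / p
  p_le_q : p ≤ q
  inv_q : 1 / q = 1 / p - α / d

namespace Exponents

variable {d : ℕ} {p q α : ℝ} (h : Exponents d p q α)
include h

theorem dim_pos : (0 : ℝ) < d := by exact_mod_cast h.one_le_dim

theorem order_eq : order p q d = α := by
  have := h.dim_pos
  rw [order, h.inv_q]; field_simp; ring

theorem one_lt_q : 1 < q := h.one_lt_p.trans_le h.p_le_q

theorem holder_p : p.HolderConjugate p.conjExponent :=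
  Real.HolderConjugate.conjExponent h.one_lt_p

theorem holder_q : q.HolderConjugate q.conjExponent :=
  Real.HolderConjugate.conjExponent h.one_lt_q

/-- The left side is the exponent in `EHtilde` and `F`; the right side is -1/d times the power of
|x| in the Riesz kernel. This is the `s` of all later lemmas. -/
theorem conj_add_inv : 1 / p.conjExponent + 1 / q = 1 - α / d := by
  have := h.holder_p.inv_add_inv_eq_one
  have := h.inv_q
  simp only [one_div] at *
  linarith

theorem order_lt_dim : α < d :=
  h.order_lt.trans (div_lt_self h.dim_pos h.one_lt_p)

end Exponents

theorem one_le_inv_rpow_self {x : ℝ} (hx : 0 < x) (hx1 : x ≤ 1) : 1 ≤ (1 / x) ^ x :=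
  Real.one_le_rpow (by rw [le_div_iff₀ hx]; linarith) hx.le

theorem inv_rpow_self_le_exp {x : ℝ} (hx : 0 < x) : (1 / x) ^ x ≤ Real.exp 1 := by
  rw [Real.rpow_def_of_pos (by positivity)]
  gcongr
  have := Real.log_le_sub_one_of_pos (x := 1 / x) (by positivity)
  calc Real.log (1 / x) * x ≤ (1 / x) * x := by gcongr; linarith
    _ = 1 := by field_simp

/-- The factor of `EHtilde` that is bounded above and below, as a function of `s = 1 - α/d`. -/
def boundedFactor (d : ℕ) (s : ℝ) : ℝ :=
  1 / (2 ^ (d * (1 - s)) * Real.pi ^ ((d : ℝ) / 2)) *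
    (Real.Gamma (1 + d * s / 2) / Real.Gamma (1 + d * (1 - s) / 2)) * (sphereArea d / d) ^ s

theorem exists_bounds_boundedFactor (d : ℕ) (hd : 1 ≤ d) :
    ∃ c C : ℝ, 0 < c ∧ 0 < C ∧ ∀ s ∈ Set.Icc (0 : ℝ) 1,
      c ≤ boundedFactor d s ∧ boundedFactor d s ≤ C := by
  have hV := sphereArea_div_pos d hd
  have h1 : ∀ s ∈ Set.Icc (0 : ℝ) 1, 0 < 1 + d * s / 2 := fun s hs => by
    have := hs.1; positivity
  have h2 : ∀ s ∈ Set.Icc (0 : ℝ) 1, 0 < 1 + d * (1 - s) / 2 := fun s hs => by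
    have := sub_nonneg.2 hs.2; positivity
  have hpos : ∀ s ∈ Set.Icc (0 : ℝ) 1, 0 < boundedFactor d s := fun s hs => by
    have := Real.Gamma_pos_of_pos (h1 s hs)
    have := Real.Gamma_pos_of_pos (h2 s hs)
    unfold boundedFactor
    positivity
  have hG : ∀ x : ℝ, 0 < x → ContinuousAt Real.Gamma x := fun x hx =>
    (Real.differentiableAt_Gamma fun m => by
      have : (0 : ℝ) ≤ m := m.cast_nonneg
      linarith).continuousAt
  have hcont : ContinuousOn (boundedFactor d) (Set.Icc 0 1) := by
    intro s hs
    apply ContinuousAt.continuousWithinAt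
    unfold boundedFactor
    refine ContinuousAt.mul (ContinuousAt.mul ?_ (ContinuousAt.div ?_ ?_ ?_)) ?_
    · refine ContinuousAt.div continuousAt_const (ContinuousAt.mul ?_ continuousAt_const)
        (by positivity)
      exact ContinuousAt.rpow continuousAt_const (by fun_prop) (Or.inl (by norm_num))
    · exact ContinuousAt.comp (f := fun s : ℝ => 1 + d * s / 2) (hG _ (h1 s hs)) (by fun_prop)
    · exact ContinuousAt.comp (f := fun s : ℝ => 1 + d * (1 - s) / 2) (hG _ (h2 s hs))
        (by fun_prop)
    · exact (Real.Gamma_pos_of_pos (h2 s hs)).ne'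
    · exact ContinuousAt.rpow continuousAt_const continuousAt_id (Or.inl hV.ne')
  obtain ⟨a, ha, hmin⟩ := isCompact_Icc.exists_isMinOn (Set.nonempty_Icc.2 zero_le_one) hcont
  obtain ⟨b, hb, hmax⟩ := isCompact_Icc.exists_isMaxOn (Set.nonempty_Icc.2 zero_le_one) hcont
  exact ⟨_, _, hpos a ha, hpos b hb, fun s hs => ⟨hmin hs, hmax hs⟩⟩

/-- Γ(ds/2) is traded for Γ(1 + ds/2), which is regular at `s = 0`; the pole becomes the factor 1/s,
and d/2 cancels. -/
theorem EHtilde_eq_boundedFactor {d : ℕ} {p q α : ℝ} (h : Exponents d p q α) {s : ℝ}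
    (hs : s = 1 / p.conjExponent + 1 / q) :
    EHtilde p q d = boundedFactor d s * s ^ s * (1 / s * (1 / (p * q.conjExponent)) *
      (p.conjExponent ^ s + q ^ s)) := by
  have hd := h.dim_pos
  have hs1 : 1 - α / d = s := by rw [hs, h.conj_add_inv]
  have hα : α = d * (1 - s) := by rw [← hs1]; field_simp; ring
  have hs0 : 0 < s := by
    have := h.holder_p.symm.pos
    have := h.holder_q.pos
    rw [hs]; positivity
  have hG : Real.Gamma (1 + d * s / 2) = d * s / 2 * Real.Gamma (d * s / 2) := by
    rw [add_comm, Real.Gamma_add_one (by positivity)]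
  have hdα : (d - α) / 2 = d * s / 2 := by rw [hα]; ring
  simp only [EHtilde, h.order_eq, hs1, ← hs, boundedFactor, hG, hdα]
  rw [hα]
  field_simp

/-- Split p'^s = p'^{1/p'} p'^{1/q} and q^s = q^{1/p'} q^{1/q}: the factors x^{1/x} lie in [1, e],
and s^s lies in [1/e, 1]. -/
theorem exists_EHtilde_bounds (d : ℕ) (hd : 1 ≤ d) :
    ∃ B : ℝ, 0 < B ∧ ∀ p q α : ℝ, Exponents d p q α →
      1 / B * F p q ≤ EHtilde p q d ∧ EHtilde p q d ≤ B * F p q := by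
  obtain ⟨c, C, hc, hC, hb⟩ := exists_bounds_boundedFactor d hd
  -- `C * e` serves the upper bound, where e bounds x^{1/x}; `e / c` serves the lower bound, where
  -- 1/e bounds s^s from below.
  refine ⟨max (C * Real.exp 1) (Real.exp 1 / c), lt_max_of_lt_left (by positivity),
    fun p q α h => ?_⟩
  have hp' := h.holder_p.symm.lt
  have hq := h.one_lt_q
  have hp0 := h.holder_p.pos
  have hq0' := h.holder_q.symm.pos
  set X := p.conjExponent
  set s := 1 / X + 1 / q with hs
  have hX0 : 0 < X := by linarith
  have hq0 : 0 < q := by linarith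
  have hs0 : 0 < s := by positivity
  have hs1 : s ≤ 1 := by
    have := h.conj_add_inv
    have h0 : 0 ≤ α / d := div_nonneg h.nonneg_order h.dim_pos.le
    rw [hs]; linarith
  obtain ⟨hb1, hb2⟩ := hb s ⟨hs0.le, hs1⟩
  have key : ∀ x : ℝ, 1 < x → 1 ≤ x ^ (1 / x) ∧ x ^ (1 / x) ≤ Real.exp 1 := fun x hx => by
    have h1 := one_le_inv_rpow_self (x := 1 / x) (by positivity)
      (by rw [div_le_one (by positivity)]; exact hx.le)
    have h2 := inv_rpow_self_le_exp (x := 1 / x) (by positivity)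
    rw [one_div_one_div] at h1 h2
    exact ⟨h1, h2⟩
  have hss : Real.exp (-1) ≤ s ^ s ∧ s ^ s ≤ 1 := by
    refine ⟨?_, Real.rpow_le_one hs0.le hs1 hs0.le⟩
    have h2 := inv_rpow_self_le_exp hs0
    rw [one_div, Real.inv_rpow hs0.le] at h2
    rw [Real.exp_neg]
    exact inv_le_of_inv_le₀ (by positivity) h2
  have eX : X ^ s = X ^ (1 / X) * X ^ (1 / q) := Real.rpow_add hX0 _ _
  have eq : q ^ s = q ^ (1 / X) * q ^ (1 / q) := Real.rpow_add hq0 _ _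
  have lo : X ^ (1 / q) + q ^ (1 / X) ≤ X ^ s + q ^ s := by
    rw [eX, eq]
    have h1 : 0 < X ^ (1 / q) := by positivity
    have h2 : 0 < q ^ (1 / X) := by positivity
    nlinarith [(key X hp').1, (key q hq).1]
  have hi : X ^ s + q ^ s ≤ Real.exp 1 * (X ^ (1 / q) + q ^ (1 / X)) := by
    rw [eX, eq]
    have h1 : 0 < X ^ (1 / q) := by positivity
    have h2 : 0 < q ^ (1 / X) := by positivity
    nlinarith [(key X hp').2, (key q hq).2]
  have hF0 : 0 < F p q := by unfold F; positivity
  have hFdef : F p q = 1 / s * (1 / (p * q.conjExponent)) * (X ^ (1 / q) + q ^ (1 / X)) := rfl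
  rw [EHtilde_eq_boundedFactor h hs]
  constructor
  · calc 1 / max (C * Real.exp 1) (Real.exp 1 / c) * F p q
        ≤ 1 / (Real.exp 1 / c) * F p q := by
          gcongr; exact le_max_right _ _
      _ = c * Real.exp (-1) * (1 / s * (1 / (p * q.conjExponent)) *
            (X ^ (1 / q) + q ^ (1 / X))) := by
          rw [hFdef, Real.exp_neg]; field_simp
      _ ≤ _ := by
          have hb0 := hc.le.trans hb1
          gcongr
          exact hss.1
  · calc _ ≤ C * 1 * (1 / s * (1 / (p * q.conjExponent)) *
            (Real.exp 1 * (X ^ (1 / q) + q ^ (1 / X)))) := by gcongr; exact hss.2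
      _ = (C * Real.exp 1) * F p q := by rw [hFdef]; ring
      _ ≤ _ := by gcongr; exact le_max_left _ _

/-- The volume π^{d/2}/Γ(d/2+1) of the unit ball cancels the Gamma and π factors, and pp' = p + p'
cancels the rest. This is what makes the Sobolev inequality an equality at α = 0. -/
theorem EHtilde_eq_one {d : ℕ} {p q : ℝ} (h : Exponents d p q 0) : EHtilde p q d = 1 := by
  have hd := h.dim_pos
  have hpq : q = p := by
    have := h.inv_q
    simpa using this
  have hs : (1 : ℝ) = 1 / p.conjExponent + 1 / q := by rw [h.conj_add_inv]; simp
  have h1 := h.holder_p.pos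
  have h2 := h.holder_p.symm.pos
  have h3 : p * p.conjExponent = p.conjExponent + p := by
    rw [h.holder_p.mul_eq_add, add_comm]
  have hG : 0 < Real.Gamma ((d : ℝ) / 2 + 1) := Real.Gamma_pos_of_pos (by positivity)
  rw [EHtilde_eq_boundedFactor h hs, boundedFactor, hpq]
  simp only [sub_self, mul_zero, Real.rpow_zero, zero_div, add_zero, Real.Gamma_one, Real.rpow_one,
    sphereArea_div_eq d h.one_le_dim, h3, mul_one, one_mul, div_one]
  rw [add_comm 1]
  have : p.conjExponent + p ≠ 0 := by positivity
  field_simp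

/-! ### The Hardy-Littlewood-Sobolev inequality with Lieb's constant -/

/-- The layer cake formula for f with respect to the measure g dμ. -/
theorem lintegral_ofReal_mul_eq_lintegral_superlevel {X : Type*} [MeasurableSpace X]
    (μ : Measure X) [SFinite μ] {f : X → ℝ} (hf : Measurable f) (hf0 : ∀ x, 0 ≤ f x)
    {g : X → ℝ≥0∞} (hg : Measurable g) :
    ∫⁻ x, ENNReal.ofReal (f x) * g x ∂μ =
      ∫⁻ a in Set.Ioi (0 : ℝ), ∫⁻ x in {x | a < f x}, g x ∂μ := by
  have h := lintegral_eq_lintegral_meas_lt (μ.withDensity g) (f := f)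
    (ae_of_all _ hf0) hf.aemeasurable
  rw [lintegral_withDensity_eq_lintegral_mul _ hg hf.ennreal_ofReal] at h
  simp only [Pi.mul_apply, mul_comm (g _)] at h
  rw [h]
  refine lintegral_congr fun a => ?_
  exact withDensity_apply _ (measurableSet_lt measurable_const hf)

theorem volume_ball_eq (d : ℕ) (hd : 1 ≤ d) (y : Euc d) {R : ℝ} (hR : 0 ≤ R) :
    volume (Metric.ball y R) = ENNReal.ofReal (sphereArea d / d * R ^ d) := by
  have : Nonempty (Fin d) := ⟨⟨0, hd⟩⟩
  rw [sphereArea_div d hd, measureReal_def, EuclideanSpace.volume_ball,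
    EuclideanSpace.volume_ball, ENNReal.toReal_mul, ENNReal.ofReal_one, one_pow,
    ENNReal.toReal_one, one_mul, ENNReal.ofReal_mul (by positivity), mul_comm,
    ENNReal.ofReal_toReal ENNReal.ofReal_ne_top, ENNReal.ofReal_pow hR, Fintype.card_fin]

theorem lintegral_Ioi_rpow {c a : ℝ} (ha : a < -1) (hc : 0 < c) :
    ∫⁻ t in Set.Ioi c, ENNReal.ofReal (t ^ a) = ENNReal.ofReal (-c ^ (a + 1) / (a + 1)) := by
  rw [← integral_Ioi_rpow_of_lt ha hc]
  refine (ofReal_integral_eq_lintegral_ofReal (integrableOn_Ioi_rpow_of_lt ha hc) ?_).symm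
  filter_upwards [ae_restrict_mem measurableSet_Ioi] with t ht
  exact Real.rpow_nonneg (hc.trans ht).le _

theorem lintegral_Ioc_rpow {c a : ℝ} (ha : -1 < a) (hc : 0 ≤ c) :
    ∫⁻ t in Set.Ioc 0 c, ENNReal.ofReal (t ^ a) = ENNReal.ofReal (c ^ (a + 1) / (a + 1)) := by
  have h := integral_rpow (a := 0) (b := c) (Or.inl ha)
  rw [Real.zero_rpow (by linarith), sub_zero, intervalIntegral.integral_of_le hc] at h
  rw [← h]
  refine (ofReal_integral_eq_lintegral_ofReal ?_ ?_).symm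
  · exact (intervalIntegral.intervalIntegrable_rpow' ha).1
  · filter_upwards [ae_restrict_mem measurableSet_Ioc] with t ht
    exact Real.rpow_nonneg ht.1.le _

/-- Among the sets of given measure, the integral of `|x - y|^{α-d}` is largest over the ball. -/
theorem setLIntegral_riesz_le {d : ℕ} (hd : 1 ≤ d) {α : ℝ} (hα : 0 < α) (hαd : α < d)
    (A : Set (Euc d)) (y : Euc d) :
    ∫⁻ x in A, ENNReal.ofReal (‖x - y‖ ^ (α - d)) ≤
      ENNReal.ofReal (d / α * (sphereArea d / d) ^ (1 - α / d)) * volume A ^ (α / d) := by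
  have hV := sphereArea_div_pos d hd
  set V := sphereArea d / d
  have hd0 : (0 : ℝ) < d := hα.trans hαd
  set s := 1 - α / d with hs
  have hs0 : 0 < s := by rw [hs, sub_pos, div_lt_one hd0]; exact hαd
  have hs1 : s < 1 := by rw [hs]; linarith [div_pos hα hd0]
  have hαs : α / d = 1 - s := by rw [hs]; ring
  clear_value s
  rcases eq_or_ne (volume A) 0 with hA0 | hA0
  · rw [Measure.restrict_eq_zero.2 hA0]; simp
  rcases eq_or_ne (volume A) ⊤ with hAT | hAT
  · rw [hAT, ENNReal.top_rpow_of_pos (by positivity), ENNReal.mul_top]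
    · exact le_top
    · simp only [ne_eq, ENNReal.ofReal_eq_zero, not_le]; positivity
  set v := (volume A).toReal with hv
  have hv0 : 0 < v := ENNReal.toReal_pos hA0 hAT
  have hAv : volume A = ENNReal.ofReal v := (ENNReal.ofReal_toReal hAT).symm
  -- `T` is the level at which the superlevel set of the kernel, a ball of volume V t^{-1/s}, has
  -- the measure of `A`. Below it the bound by |A| is the better one, above it the bound by the
  -- ball.
  set T := (V / v) ^ s with hT
  have hT0 : 0 < T := by positivity
  rw [lintegral_eq_lintegral_meas_lt _ (ae_of_all _ fun x => by positivity)
    (by fun_prop)]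
  have b1 : ∀ t : ℝ, (volume.restrict A) {x | t < ‖x - y‖ ^ (α - d)} ≤ ENNReal.ofReal v :=
    fun t => (measure_mono (Set.subset_univ _)).trans_eq (by rw [Measure.restrict_apply_univ, hAv])
  have b2 : ∀ t : ℝ, 0 < t → (volume.restrict A) {x | t < ‖x - y‖ ^ (α - d)} ≤
      ENNReal.ofReal V * ENNReal.ofReal (t ^ (-1 / s)) := by
    intro t ht
    have hsub : {x : Euc d | t < ‖x - y‖ ^ (α - d)} ⊆ Metric.ball y (t ^ (-1 / (d - α))) := by
      intro x hx
      simp only [Set.mem_ofPred_eq] at hx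
      rw [mem_ball_iff_norm]
      rcases (norm_nonneg (x - y)).eq_or_lt with h0 | h0
      · rw [← h0]; positivity
      · have h1 := Real.rpow_lt_rpow_of_neg ht hx (z := -1 / (d - α))
          (div_neg_of_neg_of_pos (by norm_num) (by linarith))
        rwa [← Real.rpow_mul h0.le, show (α - d) * (-1 / (d - α)) = 1 by
          have : (d : ℝ) - α ≠ 0 := by linarith
          field_simp; ring, Real.rpow_one] at h1
    refine (Measure.restrict_apply_le _ _).trans ((measure_mono hsub).trans_eq ?_)
    rw [volume_ball_eq d hd y (by positivity), ENNReal.ofReal_mul hV.le, ← Real.rpow_natCast,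
      ← Real.rpow_mul ht.le]
    congr 3
    have : (d : ℝ) - α ≠ 0 := by linarith
    rw [hs]; field_simp
  calc ∫⁻ t in Set.Ioi 0, (volume.restrict A) {x | t < ‖x - y‖ ^ (α - d)}
      ≤ (∫⁻ t in Set.Ioc 0 T, (volume.restrict A) {x | t < ‖x - y‖ ^ (α - d)}) +
        ∫⁻ t in Set.Ioi T, (volume.restrict A) {x | t < ‖x - y‖ ^ (α - d)} := by
        rw [← Set.Ioc_union_Ioi_eq_Ioi hT0.le]
        exact lintegral_union_le _ _ _
    _ ≤ (∫⁻ t in Set.Ioc 0 T, ENNReal.ofReal v) +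
        ∫⁻ t in Set.Ioi T, ENNReal.ofReal V * ENNReal.ofReal (t ^ (-1 / s)) := by
        refine add_le_add (lintegral_mono fun t => b1 t) ?_
        exact setLIntegral_mono' measurableSet_Ioi fun t ht => b2 t (hT0.trans ht)
    _ = ENNReal.ofReal (v * T) +
        ENNReal.ofReal (V * (-T ^ (-1 / s + 1) / (-1 / s + 1))) := by
        rw [setLIntegral_const, Real.volume_Ioc, sub_zero, ← ENNReal.ofReal_mul hv0.le,
          lintegral_const_mul _ (by fun_prop), lintegral_Ioi_rpow _ hT0,
          ← ENNReal.ofReal_mul hV.le]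
        rw [div_lt_iff₀ hs0]; linarith
    _ = ENNReal.ofReal (d / α * V ^ s) * volume A ^ (α / d) := by
        have hTs : T ^ (-1 / s) = v / V := by
          rw [hT, ← Real.rpow_mul (by positivity), show s * (-1 / s) = -1 by field_simp,
            Real.rpow_neg_one, inv_div]
        have e1 : -T ^ (-1 / s + 1) / (-1 / s + 1) = v / V * T * (s / (1 - s)) := by
          rw [Real.rpow_add hT0, hTs, Real.rpow_one]
          have h1 : 1 - s ≠ 0 := by linarith
          have h2 : -1 / s + 1 = -((1 - s) / s) := by field_simp; ring
          rw [h2]; field_simp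
        have hnn : 0 ≤ v / V * T * (s / (1 - s)) := by
          have : 0 < 1 - s := by linarith
          positivity
        rw [e1, ← ENNReal.ofReal_add (by positivity) (by positivity), hAv,
          ENNReal.ofReal_rpow_of_pos hv0, ← ENNReal.ofReal_mul (by positivity)]
        congr 1
        have hTv : T * v = V ^ s * v ^ (1 - s) := by
          rw [hT, Real.div_rpow hV.le hv0.le, Real.rpow_sub hv0, Real.rpow_one]; field_simp
        have h1 : 1 - s ≠ 0 := by linarith
        rw [hαs]
        have : (d : ℝ) / α = 1 / (1 - s) := by rw [← hαs]; field_simp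
        rw [this, mul_assoc (1 / (1 - s)), ← hTv]
        field_simp
        ring

/-- Hölder with exponents 1/(1-s) and 1/s, after inserting the weight b^{r-1} to the power 1-s and
its inverse. The relation `hr` says that the inverse weight, raised to 1/s, is b^{γ-1}, whose
integral is X^γ/γ. -/
theorem lintegral_Ioc_rpow_le_of_weight {w : ℝ → ℝ≥0∞} (hw : Measurable w) {r s γ X : ℝ}
    (hs0 : 0 < s) (hs1 : s < 1) (hγ : 0 < γ) (hr : s * (1 - γ) = (r - 1) * (1 - s)) (hX : 0 < X) :
    ∫⁻ b in Set.Ioc 0 X, w b ^ (1 - s) ≤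
      (∫⁻ b in Set.Ioi 0, w b * ENNReal.ofReal (b ^ (r - 1))) ^ (1 - s) *
        ENNReal.ofReal ((X ^ γ / γ) ^ s) := by
  have h1s : 0 < 1 - s := by linarith
  have hc : (1 / (1 - s)).HolderConjugate (1 / s) := by
    rw [Real.holderConjugate_iff]
    constructor
    · rw [lt_div_iff₀ h1s]; linarith
    · rw [one_div, one_div, inv_inv, inv_inv]; ring
  set m := (r - 1) * (1 - s) with hm
  have hmeas1 : Measurable fun b : ℝ => (w b * ENNReal.ofReal (b ^ (r - 1))) ^ (1 - s) :=
    (hw.mul (by fun_prop)).pow_const _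
  have key := ENNReal.lintegral_mul_le_Lp_mul_Lq (volume.restrict (Set.Ioc 0 X)) hc
    (f := fun b => (w b * ENNReal.ofReal (b ^ (r - 1))) ^ (1 - s))
    (g := fun b => ENNReal.ofReal (b ^ (-m)))
    hmeas1.aemeasurable (by fun_prop)
  simp only [one_div_one_div, ← ENNReal.rpow_mul, mul_one_div_cancel h1s.ne', ENNReal.rpow_one]
    at key
  calc ∫⁻ b in Set.Ioc 0 X, w b ^ (1 - s)
      = ∫⁻ b in Set.Ioc 0 X, ((fun b => (w b * ENNReal.ofReal (b ^ (r - 1))) ^ (1 - s)) *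
          fun b => ENNReal.ofReal (b ^ (-m))) b := by
        refine setLIntegral_congr_fun measurableSet_Ioc fun b hb => ?_
        have hb0 : 0 < b := hb.1
        simp only [Pi.mul_apply]
        rw [ENNReal.mul_rpow_of_nonneg _ _ h1s.le,
          ENNReal.ofReal_rpow_of_pos (Real.rpow_pos_of_pos hb0 _), mul_assoc,
          ← ENNReal.ofReal_mul (by positivity), ← Real.rpow_mul hb0.le, ← hm,
          ← Real.rpow_add hb0, add_neg_cancel, Real.rpow_zero, ENNReal.ofReal_one, mul_one]
    _ ≤ _ := key
    _ ≤ _ := by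
        gcongr
        · exact Set.Ioc_subset_Ioi_self
        · have : ∫⁻ b in Set.Ioc 0 X, ENNReal.ofReal (b ^ (-m)) ^ (1 / s) =
              ENNReal.ofReal (X ^ γ / γ) := by
            rw [show γ = (γ - 1) + 1 by ring, ← lintegral_Ioc_rpow (by linarith) hX.le]
            refine setLIntegral_congr_fun measurableSet_Ioc fun b hb => ?_
            have hb0 : 0 < b := hb.1
            rw [ENNReal.ofReal_rpow_of_pos (by positivity), ← Real.rpow_mul hb0.le]
            congr 2
            field_simp
            linarith
          rw [this, ENNReal.ofReal_rpow_of_nonneg (by positivity) hs0.le]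

/-- The cut b ≤ a^{p/r} is chosen so that Hölder on the inner integral produces exactly a^{p-1}, the
weight for which the integral of `v` is controlled. -/
theorem lintegral_mul_lintegral_Ioc_le {v w : ℝ → ℝ≥0∞} (hv : Measurable v) (hw : Measurable w)
    {p p' r r' s : ℝ} (hp : p.HolderConjugate p') (hr : r.HolderConjugate r')
    (hs : s = 1 / p' + 1 / r') (hs1 : s < 1)
    (hvp : ∫⁻ a in Set.Ioi 0, v a * ENNReal.ofReal (a ^ (p - 1)) ≤ ENNReal.ofReal (1 / p))
    (hwr : ∫⁻ b in Set.Ioi 0, w b * ENNReal.ofReal (b ^ (r - 1)) ≤ ENNReal.ofReal (1 / r)) :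
    ∫⁻ a in Set.Ioi 0, v a * ∫⁻ b in Set.Ioc 0 (a ^ (p / r)), w b ^ (1 - s) ≤
      ENNReal.ofReal (1 / (p * r) * (s * p') ^ s) := by
  have hp0 := hp.pos
  have hp0' := hp.symm.pos
  have hr0 := hr.pos
  have hr0' := hr.symm.pos
  have hs0 : 0 < s := by rw [hs]; positivity
  -- The value forced by the Hölder relation `hsr`; with it, (a^{p/r})^{γs} = a^{p/p'} = a^{p-1},
  -- which is `hpp`.
  set γ := r / (p' * s) with hγ
  have hγ0 : 0 < γ := by positivity
  have hrr := hr.inv_add_inv_eq_one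
  have hsr : s * (1 - γ) = (r - 1) * (1 - s) := by
    have h1 : s * γ = r / p' := by rw [hγ]; field_simp
    have h2 : r * s = r / p' + (r - 1) := by
      have : r' = r / (r - 1) := hr.conjugate_eq
      have h3 : r - 1 ≠ 0 := hr.sub_one_ne_zero
      rw [hs, this]; field_simp
    linarith
  have hpp : p / r * γ * s = p - 1 := by
    have : p' = p / (p - 1) := hp.conjugate_eq
    have h3 : p - 1 ≠ 0 := hp.sub_one_ne_zero
    rw [hγ, this]; field_simp
  calc ∫⁻ a in Set.Ioi 0, v a * ∫⁻ b in Set.Ioc 0 (a ^ (p / r)), w b ^ (1 - s)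
      ≤ ∫⁻ a in Set.Ioi 0, ENNReal.ofReal ((1 / r) ^ (1 - s) * (1 / γ) ^ s) *
          (v a * ENNReal.ofReal (a ^ (p - 1))) := by
        refine setLIntegral_mono' measurableSet_Ioi fun a ha => ?_
        have ha0 : 0 < a := ha
        have h1 := lintegral_Ioc_rpow_le_of_weight hw hs0 hs1 hγ0 hsr
          (Real.rpow_pos_of_pos ha0 (p / r))
        have h2 : ((a ^ (p / r)) ^ γ / γ) ^ s = (1 / γ) ^ s * a ^ (p - 1) := by
          rw [div_eq_mul_one_div, mul_comm, Real.mul_rpow (by positivity) (by positivity),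
            ← Real.rpow_mul ha0.le, ← Real.rpow_mul ha0.le, hpp]
        calc v a * ∫⁻ b in Set.Ioc 0 (a ^ (p / r)), w b ^ (1 - s)
            ≤ v a * (ENNReal.ofReal (1 / r) ^ (1 - s) *
              ENNReal.ofReal ((1 / γ) ^ s * a ^ (p - 1))) := by
              rw [← h2]
              gcongr
              refine h1.trans ?_
              gcongr
          _ = _ := by
              rw [ENNReal.ofReal_rpow_of_pos (by positivity), ENNReal.ofReal_mul (by positivity),
                ENNReal.ofReal_mul (by positivity)]
              ring
    _ = ENNReal.ofReal ((1 / r) ^ (1 - s) * (1 / γ) ^ s) *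
          ∫⁻ a in Set.Ioi 0, v a * ENNReal.ofReal (a ^ (p - 1)) :=
        lintegral_const_mul _ (hv.mul (by fun_prop))
    _ ≤ ENNReal.ofReal ((1 / r) ^ (1 - s) * (1 / γ) ^ s) * ENNReal.ofReal (1 / p) := by gcongr
    _ = _ := by
        rw [← ENNReal.ofReal_mul (by positivity)]
        congr 1
        have : 1 / γ = (1 / r) * (s * p') := by rw [hγ]; field_simp
        rw [this, Real.mul_rpow (by positivity) (by positivity), ← mul_assoc,
          ← Real.rpow_add (by positivity), sub_add_cancel, Real.rpow_one]
        field_simp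

/-- The quarter plane is covered by the two sides of the curve b^r = a^p. On each side one entry of
the minimum is kept, and the two sides are exchanged by swapping (v, p) with (w, r). -/
theorem lintegral_lintegral_min_le {v w : ℝ → ℝ≥0∞} (hv : Measurable v) (hw : Measurable w)
    {p p' r r' s : ℝ} (hp : p.HolderConjugate p') (hr : r.HolderConjugate r')
    (hs : s = 1 / p' + 1 / r') (hs1 : s < 1)
    (hvp : ∫⁻ a in Set.Ioi 0, v a * ENNReal.ofReal (a ^ (p - 1)) ≤ ENNReal.ofReal (1 / p))
    (hwr : ∫⁻ b in Set.Ioi 0, w b * ENNReal.ofReal (b ^ (r - 1)) ≤ ENNReal.ofReal (1 / r)) :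
    ∫⁻ b in Set.Ioi (0 : ℝ), ∫⁻ a in Set.Ioi (0 : ℝ),
        min (v a * w b ^ (1 - s)) (w b * v a ^ (1 - s)) ≤
      ENNReal.ofReal (1 / (p * r) * ((s * p') ^ s + (s * r') ^ s)) := by
  have hp0 := hp.pos
  have hp0' := hp.symm.pos
  have hr0 := hr.pos
  have hr0' := hr.symm.pos
  have hs0 : 0 < s := by rw [hs]; positivity
  have t1 := lintegral_mul_lintegral_Ioc_le hv hw hp hr hs hs1 hvp hwr
  have t2 := lintegral_mul_lintegral_Ioc_le hw hv hr hp (by rw [hs]; ring) hs1 hwr hvp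
  let S : Set (ℝ × ℝ) := {z | z.1 ≤ z.2 ^ (p / r)}
  let S' : Set (ℝ × ℝ) := {z | z.2 ≤ z.1 ^ (r / p)}
  have hS : MeasurableSet S := measurableSet_le measurable_fst (by fun_prop)
  have hS' : MeasurableSet S' := measurableSet_le measurable_snd (by fun_prop)
  let F₁ : ℝ → ℝ → ℝ≥0∞ := fun b a => S.indicator (fun z => v z.2 * w z.1 ^ (1 - s)) (b, a)
  let F₂ : ℝ → ℝ → ℝ≥0∞ := fun b a => S'.indicator (fun z => w z.1 * v z.2 ^ (1 - s)) (b, a)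
  have hF₁ : Measurable (Function.uncurry F₁) :=
    Measurable.indicator (by fun_prop) hS
  have hF₂ : Measurable (Function.uncurry F₂) :=
    Measurable.indicator (by fun_prop) hS'
  have hle : ∀ b ∈ Set.Ioi (0 : ℝ), ∀ a ∈ Set.Ioi (0 : ℝ),
      min (v a * w b ^ (1 - s)) (w b * v a ^ (1 - s)) ≤ F₁ b a + F₂ b a := by
    intro b hb a ha
    by_cases h : b ≤ a ^ (p / r)
    · have : F₁ b a = v a * w b ^ (1 - s) := Set.indicator_of_mem (s := S) h _
      rw [this]
      exact (min_le_left _ _).trans le_self_add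
    · have h' : (b, a) ∈ S' := by
        push Not at h
        have h1 := Real.rpow_le_rpow (by positivity [Set.mem_Ioi.1 ha]) h.le
          (show 0 ≤ r / p by positivity)
        rwa [← Real.rpow_mul (le_of_lt ha), show p / r * (r / p) = 1 by field_simp,
          Real.rpow_one] at h1
      have : F₂ b a = w b * v a ^ (1 - s) := Set.indicator_of_mem h' _
      rw [this]
      exact (min_le_right _ _).trans le_add_self
  have restr : ∀ (u : ℝ → ℝ≥0∞) (c : ℝ≥0∞) (Y : ℝ), Measurable u →
      ∫⁻ b in Set.Ioi 0, (Set.Iic Y).indicator (fun b => c * u b) b =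
        c * ∫⁻ b in Set.Ioc 0 Y, u b := by
    intro u c Y hu
    rw [setLIntegral_indicator measurableSet_Iic, lintegral_const_mul _ hu, Set.inter_comm]
    rfl
  calc ∫⁻ b in Set.Ioi (0 : ℝ), ∫⁻ a in Set.Ioi (0 : ℝ),
        min (v a * w b ^ (1 - s)) (w b * v a ^ (1 - s))
      ≤ ∫⁻ b in Set.Ioi (0 : ℝ), ∫⁻ a in Set.Ioi (0 : ℝ), F₁ b a + F₂ b a :=
        setLIntegral_mono' measurableSet_Ioi fun b hb =>
          setLIntegral_mono' measurableSet_Ioi fun a ha => hle b hb a ha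
    _ = (∫⁻ b in Set.Ioi (0 : ℝ), ∫⁻ a in Set.Ioi (0 : ℝ), F₁ b a) +
        ∫⁻ b in Set.Ioi (0 : ℝ), ∫⁻ a in Set.Ioi (0 : ℝ), F₂ b a := by
        have hm : Measurable fun b => ∫⁻ a in Set.Ioi (0 : ℝ), F₁ b a := hF₁.lintegral_prod_right'
        rw [← lintegral_add_left hm]
        refine lintegral_congr fun b => ?_
        exact lintegral_add_left (hF₁.comp measurable_prodMk_left) _
    _ = (∫⁻ a in Set.Ioi (0 : ℝ), v a * ∫⁻ b in Set.Ioc 0 (a ^ (p / r)), w b ^ (1 - s)) +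
        ∫⁻ b in Set.Ioi (0 : ℝ), w b * ∫⁻ a in Set.Ioc 0 (b ^ (r / p)), v a ^ (1 - s) := by
        rw [lintegral_lintegral_swap hF₁.aemeasurable]
        congr 1
        · refine lintegral_congr fun a => ?_
          rw [← restr _ _ _ (hw.pow_const _)]
          rfl
        · refine lintegral_congr fun b => ?_
          rw [← restr _ _ _ (hv.pow_const _)]
          rfl
    _ ≤ _ := by
        refine (add_le_add t1 t2).trans_eq ?_
        rw [← ENNReal.ofReal_add (by positivity) (by positivity)]
        congr 1
        ring

theorem lintegral_bilinear_eq_lintegral_superlevel {X : Type*} [MeasurableSpace X]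
    (μ : Measure X) [SFinite μ] {f h : X → ℝ} (hf : Measurable f) (hf0 : ∀ x, 0 ≤ f x)
    (hh : Measurable h) (hh0 : ∀ x, 0 ≤ h x) {k : X → X → ℝ≥0∞}
    (hk : Measurable (Function.uncurry k)) :
    ∫⁻ x, ENNReal.ofReal (f x) * ∫⁻ y, ENNReal.ofReal (h y) * k x y ∂μ ∂μ =
      ∫⁻ b in Set.Ioi (0 : ℝ), ∫⁻ a in Set.Ioi (0 : ℝ),
        ∫⁻ x in {x | a < f x}, ∫⁻ y in {y | b < h y}, k x y ∂μ ∂μ := by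
  have hkx : ∀ x, Measurable (k x) := fun x => hk.comp measurable_prodMk_left
  have hI : Measurable fun z : ℝ × X => ∫⁻ y in {y | z.1 < h y}, k z.2 y ∂μ := by
    have : (fun z : ℝ × X => ∫⁻ y in {y | z.1 < h y}, k z.2 y ∂μ) = fun z => ∫⁻ y,
        ({t : (ℝ × X) × X | t.1.1 < h t.2}.indicator (fun t => k t.1.2 t.2)) (z, y) ∂μ := by
      funext z
      rw [← lintegral_indicator (measurableSet_lt measurable_const hh)]
      rfl
    rw [this]
    refine Measurable.lintegral_prod_right' (Measurable.indicator ?_ ?_)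
    · exact hk.comp ((measurable_snd.comp measurable_fst).prodMk measurable_snd)
    · exact measurableSet_lt (measurable_fst.comp measurable_fst) (hh.comp measurable_snd)
  have hIb : ∀ b : ℝ, Measurable fun x => ∫⁻ y in {y | b < h y}, k x y ∂μ := fun b =>
    hI.comp (measurable_prodMk_left (x := b))
  have hIx : ∀ x, Measurable fun b : ℝ => ∫⁻ y in {y | b < h y}, k x y ∂μ := fun x =>
    hI.comp (measurable_prodMk_right (y := x))
  calc ∫⁻ x, ENNReal.ofReal (f x) * ∫⁻ y, ENNReal.ofReal (h y) * k x y ∂μ ∂μ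
      = ∫⁻ x, (∫⁻ b in Set.Ioi (0 : ℝ),
          ENNReal.ofReal (f x) * ∫⁻ y in {y | b < h y}, k x y ∂μ) ∂μ := by
        refine lintegral_congr fun x => ?_
        rw [lintegral_ofReal_mul_eq_lintegral_superlevel _ hh hh0 (hkx x),
          lintegral_const_mul _ (hIx x)]
    _ = ∫⁻ b in Set.Ioi (0 : ℝ), ∫⁻ x,
          ENNReal.ofReal (f x) * ∫⁻ y in {y | b < h y}, k x y ∂μ ∂μ := by
        refine lintegral_lintegral_swap (Measurable.aemeasurable ?_)
        exact (hf.comp measurable_fst).ennreal_ofReal.mul (hI.comp measurable_swap)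
    _ = _ := by
        refine lintegral_congr fun b => ?_
        exact lintegral_ofReal_mul_eq_lintegral_superlevel _ hf hf0 (hIb b)

theorem measurable_riesz (d : ℕ) (α : ℝ) :
    Measurable (Function.uncurry fun x y : Euc d => ENNReal.ofReal (‖x - y‖ ^ (α - d))) :=
  ENNReal.measurable_ofReal.comp (((measurable_fst.sub measurable_snd).norm).pow_const _)

/-- The inner integral is at most that over a ball of equal volume, whatever the outer point; the
two orders of integration give the two entries of the minimum. -/
theorem lintegral_lintegral_riesz_le {d : ℕ} (hd : 1 ≤ d) {α : ℝ} (hα : 0 < α) (hαd : α < d)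
    (A B : Set (Euc d)) :
    ∫⁻ x in A, ∫⁻ y in B, ENNReal.ofReal (‖x - y‖ ^ (α - d)) ≤
      ENNReal.ofReal (d / α * (sphereArea d / d) ^ (1 - α / d)) *
        min (volume A * volume B ^ (α / d)) (volume B * volume A ^ (α / d)) := by
  set D := ENNReal.ofReal (d / α * (sphereArea d / d) ^ (1 - α / d))
  have e : ∀ A B : Set (Euc d), ∫⁻ x in A, ∫⁻ y in B, ENNReal.ofReal (‖x - y‖ ^ (α - d)) ≤
      D * (volume A * volume B ^ (α / d)) := by
    intro A B
    calc ∫⁻ x in A, ∫⁻ y in B, ENNReal.ofReal (‖x - y‖ ^ (α - d))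
        ≤ ∫⁻ _ in A, D * volume B ^ (α / d) := by
          refine lintegral_mono fun x => ?_
          simp_rw [norm_sub_rev x]
          exact setLIntegral_riesz_le hd hα hαd B x
      _ = _ := by rw [setLIntegral_const]; ring
  rcases min_choice (volume A * volume B ^ (α / d)) (volume B * volume A ^ (α / d)) with h | h <;>
    rw [h]
  · exact e A B
  · rw [lintegral_lintegral_swap (measurable_riesz d α).aemeasurable]
    simp_rw [norm_sub_rev]
    exact e B A

theorem lintegral_riesz_le_lintegral_min {d : ℕ} (hd : 1 ≤ d) {α : ℝ} (hα : 0 < α) (hαd : α < d)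
    {f h : Euc d → ℝ} (hf : Measurable f) (hf0 : ∀ x, 0 ≤ f x) (hh : Measurable h)
    (hh0 : ∀ x, 0 ≤ h x) :
    ∫⁻ x, ENNReal.ofReal (f x) * ∫⁻ y, ENNReal.ofReal (h y) * ENNReal.ofReal (‖x - y‖ ^ (α - d)) ≤
      ENNReal.ofReal (d / α * (sphereArea d / d) ^ (1 - α / d)) *
        ∫⁻ b in Set.Ioi (0 : ℝ), ∫⁻ a in Set.Ioi (0 : ℝ),
          min (volume {x | a < f x} * volume {y | b < h y} ^ (α / d))
            (volume {y | b < h y} * volume {x | a < f x} ^ (α / d)) := by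
  rw [lintegral_bilinear_eq_lintegral_superlevel volume hf hf0 hh hh0 (measurable_riesz d α),
    ← lintegral_const_mul' _ _ ENNReal.ofReal_ne_top]
  refine lintegral_mono fun b => ?_
  rw [← lintegral_const_mul' _ _ ENNReal.ofReal_ne_top]
  exact lintegral_mono fun a => lintegral_lintegral_riesz_le hd hα hαd _ _

theorem measurable_volume_superlevel {X : Type*} [MeasurableSpace X] (μ : Measure X)
    (f : X → ℝ) : Measurable fun a : ℝ => μ {x | a < f x} :=
  Antitone.measurable fun _ _ hab => measure_mono fun _ hx => lt_of_le_of_lt hab hx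

theorem lintegral_superlevel_le {X : Type*} [MeasurableSpace X] (μ : Measure X)
    {f : X → ℝ} (hf : Measurable f) (hf0 : ∀ x, 0 ≤ f x) {p : ℝ} (hp : 0 < p)
    (hfp : ∫⁻ x, ENNReal.ofReal (f x ^ p) ∂μ ≤ 1) :
    ∫⁻ a in Set.Ioi 0, μ {x | a < f x} * ENNReal.ofReal (a ^ (p - 1)) ≤
      ENNReal.ofReal (1 / p) := by
  rw [lintegral_rpow_eq_lintegral_meas_lt_mul μ (ae_of_all _ hf0) hf.aemeasurable hp] at hfp
  have hp0 : ENNReal.ofReal p ≠ 0 := by simpa using hp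
  rw [one_div, ENNReal.ofReal_inv_of_pos hp]
  rwa [mul_comm, ← ENNReal.le_div_iff_mul_le (Or.inl hp0) (Or.inl ENNReal.ofReal_ne_top),
    one_div] at hfp

/-- The Hardy-Littlewood-Sobolev inequality with Lieb's constant, for normalized functions. -/
theorem hardyLittlewoodSobolev_of_le_one {d : ℕ} {p q α : ℝ} (he : Exponents d p q α) (hα : 0 < α)
    {f h : Euc d → ℝ} (hf : Measurable f) (hf0 : ∀ x, 0 ≤ f x) (hh : Measurable h)
    (hh0 : ∀ x, 0 ≤ h x) (hfp : ∫⁻ x, ENNReal.ofReal (f x ^ p) ≤ 1)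
    (hhq : ∫⁻ x, ENNReal.ofReal (h x ^ q.conjExponent) ≤ 1) :
    ∫⁻ x, ENNReal.ofReal (f x) * ∫⁻ y, ENNReal.ofReal (h y) * ENNReal.ofReal (‖x - y‖ ^ (α - d)) ≤
      ENNReal.ofReal (liebBound p q d α) := by
  have hd := he.dim_pos
  have hp0 := he.holder_p.pos
  have hp0' := he.holder_p.symm.pos
  have hq0 := he.holder_q.pos
  have hq0' := he.holder_q.symm.pos
  have hs := he.conj_add_inv
  have hαd : 0 < α / d := by positivity
  refine (lintegral_riesz_le_lintegral_min he.one_le_dim hα he.order_lt_dim hf hf0 hh hh0).trans ?_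
  have key := lintegral_lintegral_min_le (measurable_volume_superlevel volume f)
    (measurable_volume_superlevel volume h) he.holder_p he.holder_q.symm hs.symm (by linarith)
    (lintegral_superlevel_le _ hf hf0 hp0 hfp) (lintegral_superlevel_le _ hh hh0 hq0' hhq)
  -- With s = 1 - α/d, the exponent 1 - s is α/d, as in the bound by superlevel sets.
  rw [sub_sub_cancel] at key
  refine (mul_le_mul_right key _).trans_eq ?_
  have hs0 : 0 < 1 - α / d := by rw [← hs]; positivity
  have hV := sphereArea_div_pos d he.one_le_dim
  rw [← ENNReal.ofReal_mul (by positivity), liebBound, hs, Real.mul_rpow hs0.le hp0'.le,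
    Real.mul_rpow hs0.le hq0.le]
  congr 1
  ring

/-- The Hardy-Littlewood-Sobolev inequality with Lieb's constant. -/
theorem hardyLittlewoodSobolev {d : ℕ} {p q α : ℝ} (he : Exponents d p q α) (hα : 0 < α)
    {f h : Euc d → ℝ} (hf : Measurable f) (hf0 : ∀ x, 0 ≤ f x) (hh : Measurable h)
    (hh0 : ∀ x, 0 ≤ h x) {A B : ℝ} (hA : 0 < A) (hB : 0 < B)
    (hfp : ∫⁻ x, ENNReal.ofReal (f x ^ p) ≤ ENNReal.ofReal (A ^ p))
    (hhq : ∫⁻ x, ENNReal.ofReal (h x ^ q.conjExponent) ≤ ENNReal.ofReal (B ^ q.conjExponent)) :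
    ∫⁻ x, ENNReal.ofReal (f x) * ∫⁻ y, ENNReal.ofReal (h y) * ENNReal.ofReal (‖x - y‖ ^ (α - d)) ≤
      ENNReal.ofReal (liebBound p q d α * A * B) := by
  have scale : ∀ {g : Euc d → ℝ} {C t : ℝ}, (∀ x, 0 ≤ g x) → 0 < C →
      ∫⁻ x, ENNReal.ofReal (g x ^ t) ≤ ENNReal.ofReal (C ^ t) →
      ∫⁻ x, ENNReal.ofReal ((C⁻¹ * g x) ^ t) ≤ 1 := by
    intro g C t hg hC hgt
    have hCt : 0 < C ^ t := by positivity
    calc ∫⁻ x, ENNReal.ofReal ((C⁻¹ * g x) ^ t)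
        = ENNReal.ofReal ((C ^ t)⁻¹) * ∫⁻ x, ENNReal.ofReal (g x ^ t) := by
          rw [← lintegral_const_mul' _ _ ENNReal.ofReal_ne_top]
          refine lintegral_congr fun x => ?_
          rw [← ENNReal.ofReal_mul (by positivity), Real.mul_rpow (by positivity) (hg x),
            Real.inv_rpow hC.le]
      _ ≤ ENNReal.ofReal ((C ^ t)⁻¹) * ENNReal.ofReal (C ^ t) := by gcongr
      _ = 1 := by rw [← ENNReal.ofReal_mul (by positivity), inv_mul_cancel₀ hCt.ne',
            ENNReal.ofReal_one]
  have key := hardyLittlewoodSobolev_of_le_one he hα (hf.const_mul A⁻¹)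
    (fun x => mul_nonneg (by positivity) (hf0 x)) (hh.const_mul B⁻¹)
    (fun x => mul_nonneg (by positivity) (hh0 x)) (scale hf0 hA hfp) (scale hh0 hB hhq)
  have ef : ∀ x, ENNReal.ofReal (f x) = ENNReal.ofReal A * ENNReal.ofReal (A⁻¹ * f x) := fun x => by
    rw [← ENNReal.ofReal_mul hA.le, mul_inv_cancel_left₀ hA.ne']
  have eh : ∀ x, ENNReal.ofReal (h x) = ENNReal.ofReal B * ENNReal.ofReal (B⁻¹ * h x) := fun x => by
    rw [← ENNReal.ofReal_mul hB.le, mul_inv_cancel_left₀ hB.ne']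
  calc ∫⁻ x, ENNReal.ofReal (f x) * ∫⁻ y, ENNReal.ofReal (h y) * ENNReal.ofReal (‖x - y‖ ^ (α - d))
      = ENNReal.ofReal A * ENNReal.ofReal B * ∫⁻ x, ENNReal.ofReal (A⁻¹ * f x) *
          ∫⁻ y, ENNReal.ofReal (B⁻¹ * h y) * ENNReal.ofReal (‖x - y‖ ^ (α - d)) := by
        rw [← lintegral_const_mul' _ _ (ENNReal.mul_ne_top ENNReal.ofReal_ne_top
          ENNReal.ofReal_ne_top)]
        refine lintegral_congr fun x => ?_
        simp_rw [ef x, eh, mul_assoc, lintegral_const_mul' _ _ (ENNReal.ofReal_ne_top (r := B))]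
        ring
    _ ≤ ENNReal.ofReal A * ENNReal.ofReal B * ENNReal.ofReal (liebBound p q d α) := by gcongr
    _ = _ := by
        rw [ENNReal.ofReal_mul' hB.le, ENNReal.ofReal_mul' hA.le]
        ring

/-! ### The heat kernel -/

/-- The heat kernel `(4πt)^{-d/2} exp(-|z|²/(4t))` of `ℝ^d`. -/
def heatKernel (d : ℕ) (t : ℝ) (z : Euc d) : ℝ :=
  (1 / (4 * Real.pi * t)) ^ ((d : ℝ) / 2) * Real.exp (-(1 / (4 * t)) * ‖z‖ ^ 2)

/-- The plane wave at `x` damped by the heat semigroup, `exp(-t|2πξ|² + 2πi x·ξ)`. -/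
def heatWave (d : ℕ) (t : ℝ) (x ξ : Euc d) : ℂ :=
  Complex.exp (-((4 * Real.pi ^ 2 * t : ℝ) : ℂ) * ‖ξ‖ ^ 2 + 2 * Real.pi * Complex.I * inner ℝ x ξ)

theorem heatKernel_nonneg {d : ℕ} {t : ℝ} (ht : 0 < t) (z : Euc d) : 0 ≤ heatKernel d t z := by
  unfold heatKernel; positivity

theorem continuous_heatWave (d : ℕ) (t : ℝ) (x : Euc d) : Continuous (heatWave d t x) := by
  unfold heatWave; fun_prop

theorem norm_heatWave (d : ℕ) (t : ℝ) (x ξ : Euc d) :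
    ‖heatWave d t x ξ‖ = Real.exp (-(t * (2 * Real.pi * ‖ξ‖) ^ 2)) := by
  rw [heatWave, Complex.norm_exp]
  congr 1
  simp [← Complex.ofReal_pow]
  ring

theorem heatWave_eq (d : ℕ) (t : ℝ) (x ξ : Euc d) :
    heatWave d t x ξ = Real.exp (-(t * (2 * Real.pi * ‖ξ‖) ^ 2)) *
      Complex.exp (2 * Real.pi * inner ℝ ξ x * Complex.I) := by
  rw [heatWave, Complex.ofReal_exp, ← Complex.exp_add, real_inner_comm]
  congr 1
  push_cast
  ring

theorem integrable_heatWave {d : ℕ} {t : ℝ} (ht : 0 < t) (x : Euc d) :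
    Integrable (heatWave d t x) := by
  refine GaussianFourier.integrable_cexp_neg_mul_sq_norm_add ?_ _ _
  rw [Complex.ofReal_re]
  positivity

theorem fourier_heatWave {d : ℕ} {t : ℝ} (ht : 0 < t) (x y : Euc d) :
    𝓕 (heatWave d t x) y = heatKernel d t (x - y) := by
  have h := fourier_gaussian_innerProductSpace' (V := Euc d)
    (b := ((4 * Real.pi ^ 2 * t : ℝ) : ℂ)) (by rw [Complex.ofReal_re]; positivity) x y
  refine h.trans ?_
  rw [heatKernel, Complex.ofReal_mul ((1 / (4 * Real.pi * t)) ^ ((d : ℝ) / 2)),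
    Complex.ofReal_cpow (by positivity), Complex.ofReal_exp]
  have := Real.pi_pos.ne'
  congr 2
  · push_cast
    have : (Real.pi : ℂ) ≠ 0 := by exact_mod_cast this
    field_simp
  · simp
  · push_cast
    have : (Real.pi : ℂ) ≠ 0 := by exact_mod_cast this
    have : (t : ℂ) ≠ 0 := by exact_mod_cast ht.ne'
    field_simp

theorem integrable_heatKernel {d : ℕ} {t : ℝ} (ht : 0 < t) : Integrable (heatKernel d t) := by
  refine Integrable.const_mul ?_ _
  have := GaussianFourier.integrable_cexp_neg_mul_sq_norm_add (V := Euc d)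
    (b := ((1 / (4 * t) : ℝ) : ℂ)) (by rw [Complex.ofReal_re]; positivity) 0 0
  refine this.norm.congr (ae_of_all _ fun z => ?_)
  simp only [Complex.norm_exp]
  congr 1
  simp [← Complex.ofReal_pow]

theorem integral_heatKernel {d : ℕ} {t : ℝ} (ht : 0 < t) : ∫ z, heatKernel d t z = 1 := by
  have h := GaussianFourier.integral_rexp_neg_mul_sq_norm (V := Euc d) (b := 1 / (4 * t))
    (by positivity)
  simp only [heatKernel]
  rw [integral_const_mul, h, finrank_euclideanSpace_fin, ← Real.mul_rpow (by positivity) (by positivity)]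
  have : 1 / (4 * Real.pi * t) * (Real.pi / (1 / (4 * t))) = 1 := by
    field_simp
  rw [this, Real.one_rpow]

/-- The multiplication formula moves the Fourier transform from `w` to the heat kernel. Only `w` has
to be integrable, not its inverse transform, which matters when `w` carries the nonsmooth symbol
|2πξ|^α. -/
theorem integral_heatKernel_mul_fourierInv {d : ℕ} {t : ℝ} (ht : 0 < t) (x : Euc d)
    {w : Euc d → ℂ} (hw : Integrable w) :
    ∫ y, (heatKernel d t (x - y) : ℂ) * 𝓕⁻ w y = ∫ ξ, heatWave d t x ξ * w ξ := by
  have hG : 𝓕 (heatWave d t x) = fun y => (heatKernel d t (x - y) : ℂ) :=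
    funext fun y => fourier_heatWave ht x y
  have hGi : Integrable (𝓕 (heatWave d t x)) := by
    rw [hG]
    exact ((integrable_heatKernel ht).comp_sub_left x).ofReal
  have hinv := Continuous.fourierInv_fourier_eq (continuous_heatWave d t x)
    (integrable_heatWave ht x) hGi
  have flip := VectorFourier.integral_bilin_fourierIntegral_eq_flip (μ := volume) (ν := volume)
    (L := innerₗ (Euc d)) (ContinuousLinearMap.mul ℂ ℂ) Real.continuous_fourierChar
    (by exact continuous_inner) hGi (f := 𝓕 (heatWave d t x)) (g := fun ξ => w (-ξ)) hw.comp_neg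
  have e1 : ∀ y, 𝓕⁻ w y = 𝓕 (fun ξ => w (-ξ)) y := fun y => by
    rw [Real.fourierInv_eq_fourier_comp_neg]
  have e2 : ∀ ξ, heatWave d t x ξ = 𝓕 (𝓕 (heatWave d t x)) (-ξ) := fun ξ => by
    rw [← Real.fourierInv_eq_fourier_neg, hinv]
  calc ∫ y, (heatKernel d t (x - y) : ℂ) * 𝓕⁻ w y
      = ∫ y, 𝓕 (heatWave d t x) y * 𝓕 (fun ξ => w (-ξ)) y := by simp_rw [e1, hG]
    _ = ∫ ξ, 𝓕 (𝓕 (heatWave d t x)) ξ * w (-ξ) := by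
        refine Eq.trans ?_ flip.symm
        simp only [ContinuousLinearMap.mul_apply', flip_innerₗ]
        rfl
    _ = ∫ ξ, 𝓕 (𝓕 (heatWave d t x)) (-ξ) * w ξ := by
        rw [← integral_neg_eq_self]
        simp_rw [neg_neg]
    _ = _ := by simp_rw [← e2]

/-! ### The Riesz potential as a superposition of heat kernels -/

/-- The substitution t ↦ 1/t turns this into the Gamma integral. -/
theorem lintegral_rpow_mul_exp_neg_div {β c : ℝ} (hβ : 0 < β) (hc : 0 < c) :
    ∫⁻ t in Set.Ioi (0 : ℝ), ENNReal.ofReal (t ^ (-β - 1) * Real.exp (-(c / t))) =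
      ENNReal.ofReal ((1 / c) ^ β * Real.Gamma β) := by
  have h1 := Real.integral_rpow_mul_exp_neg_mul_Ioi hβ hc
  have h2 := integral_comp_rpow_Ioi (fun t : ℝ => t ^ (β - 1) * Real.exp (-(c * t)))
    (p := -1) (by norm_num)
  rw [h1] at h2
  have h3 : ∫ t in Set.Ioi (0 : ℝ), t ^ (-β - 1) * Real.exp (-(c / t)) =
      (1 / c) ^ β * Real.Gamma β := by
    rw [← h2]
    refine setIntegral_congr_fun measurableSet_Ioi fun t ht => ?_
    have ht0 : 0 < t := ht
    rw [abs_neg, abs_one, one_mul, smul_eq_mul, ← Real.rpow_mul ht0.le, ← mul_assoc, ← Real.rpow_add ht0, Real.rpow_neg_one,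
      div_eq_mul_inv]
    congr 2
    ring
  rw [← h3]
  have hG := Real.Gamma_pos_of_pos hβ
  refine (ofReal_integral_eq_lintegral_ofReal (Integrable.of_integral_ne_zero ?_) ?_).symm
  · rw [h3]; positivity
  · filter_upwards [ae_restrict_mem measurableSet_Ioi] with t ht
    have ht0 : 0 < t := ht
    positivity

/-- The same weight t^{α/2-1} applied to e^{-tλ} yields Γ(α/2) λ^{-α/2}
(`integral_rpow_mul_exp_neg_mul`); comparing the two identifies the Riesz kernel and its constant.
-/
theorem lintegral_rpow_mul_heatKernel {d : ℕ} {α : ℝ} (hα : 0 < α) (hαd : α < d)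
    {z : Euc d} (hz : z ≠ 0) :
    ∫⁻ t in Set.Ioi (0 : ℝ), ENNReal.ofReal (t ^ (α / 2 - 1) * heatKernel d t z) =
      ENNReal.ofReal (Real.Gamma (α / 2) * rieszConst d α * ‖z‖ ^ (α - d)) := by
  have hz0 : 0 < ‖z‖ := norm_pos_iff.2 hz
  have hβ : 0 < (d - α) / 2 := by linarith
  have hG := Real.Gamma_pos_of_pos hβ
  have hG' := Real.Gamma_pos_of_pos (half_pos hα)
  calc ∫⁻ t in Set.Ioi (0 : ℝ), ENNReal.ofReal (t ^ (α / 2 - 1) * heatKernel d t z)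
      = ∫⁻ t in Set.Ioi (0 : ℝ), ENNReal.ofReal ((1 / (4 * Real.pi)) ^ ((d : ℝ) / 2)) *
          ENNReal.ofReal (t ^ (-((d - α) / 2) - 1) * Real.exp (-((‖z‖ ^ 2 / 4) / t))) := by
        refine setLIntegral_congr_fun measurableSet_Ioi fun t ht => ?_
        have ht0 : 0 < t := ht
        rw [← ENNReal.ofReal_mul (by positivity), heatKernel]
        congr 1
        have e1 : (1 / (4 * Real.pi * t)) ^ ((d : ℝ) / 2) =
            (1 / (4 * Real.pi)) ^ ((d : ℝ) / 2) * t ^ (-((d : ℝ) / 2)) := by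
          rw [Real.rpow_neg ht0.le, ← Real.inv_rpow ht0.le,
            ← Real.mul_rpow (by positivity) (by positivity)]
          congr 1
          field_simp
        have e2 : t ^ (-((d - α) / 2) - 1) = t ^ (α / 2 - 1) * t ^ (-((d : ℝ) / 2)) := by
          rw [← Real.rpow_add ht0]; congr 1; ring
        have e3 : -(1 / (4 * t)) * ‖z‖ ^ 2 = -((‖z‖ ^ 2 / 4) / t) := by field_simp
        rw [e1, e2, e3]
        ring
    _ = _ := by
        rw [lintegral_const_mul' _ _ ENNReal.ofReal_ne_top,
          lintegral_rpow_mul_exp_neg_div hβ (by positivity), ← ENNReal.ofReal_mul (by positivity)]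
        congr 1
        rw [rieszConst]
        have e1 : (1 / (‖z‖ ^ 2 / 4)) ^ (((d : ℝ) - α) / 2) = 2 ^ ((d : ℝ) - α) * ‖z‖ ^ (α - d) := by
          rw [show 1 / (‖z‖ ^ 2 / 4) = (2 * ‖z‖⁻¹) ^ (2 : ℝ) by
            rw [Real.rpow_two]; field_simp; norm_num, ← Real.rpow_mul (by positivity),
            Real.mul_rpow (by positivity) (by positivity), Real.inv_rpow hz0.le,
            ← Real.rpow_neg hz0.le]
          congr 2 <;> ring
        have e2 : (1 / (4 * Real.pi)) ^ ((d : ℝ) / 2) = 1 / (2 ^ (d : ℝ) * Real.pi ^ ((d : ℝ) / 2)) := by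
          rw [Real.div_rpow (by positivity) (by positivity), Real.one_rpow,
            Real.mul_rpow (by positivity) (by positivity)]
          congr 2
          rw [show (4 : ℝ) = 2 ^ (2 : ℝ) by norm_num, ← Real.rpow_mul (by positivity)]
          congr 1; ring
        rw [e1, e2, Real.rpow_sub (by positivity)]
        field_simp

theorem integral_rpow_mul_exp_neg_mul {α c : ℝ} (hα : 0 < α) (hc : 0 < c) :
    ∫ t in Set.Ioi (0 : ℝ), t ^ (α / 2 - 1) * Real.exp (-(t * c ^ 2)) =
      Real.Gamma (α / 2) * c ^ (-α) := by
  have h := Real.integral_rpow_mul_exp_neg_mul_Ioi (half_pos hα) (pow_pos hc 2)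
  simp_rw [mul_comm (c ^ 2)] at h
  rw [h, mul_comm]
  congr 1
  rw [one_div, Real.inv_rpow (by positivity), ← Real.rpow_natCast, ← Real.rpow_mul hc.le,
    ← Real.rpow_neg hc.le]
  congr 1
  push_cast; ring

theorem rieszConst_pos {d : ℕ} {α : ℝ} (hα : 0 < α) (hαd : α < d) : 0 < rieszConst d α := by
  have h1 := Real.Gamma_pos_of_pos (half_pos hα)
  have h2 := Real.Gamma_pos_of_pos (show 0 < (d - α) / 2 by linarith)
  unfold rieszConst
  positivity

/-- The symbol `(1 + |2πξ|²)^{α/2}` of `(I + Δ)^{α/2}`. -/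
def besselSymbol (d : ℕ) (α : ℝ) (ξ : Euc d) : ℂ :=
  (((1 + (2 * Real.pi * ‖ξ‖) ^ 2) ^ (α / 2) : ℝ) : ℂ)

theorem besselSymbol_hasTemperateGrowth (d : ℕ) (α : ℝ) :
    (besselSymbol d α).HasTemperateGrowth :=
  hasTemperateGrowth_besselSymbol d α

/-- The symbol may fail to be smooth at the origin, so the product need not be Schwartz; it is
dominated by its smooth counterpart (1+|2πξ|²)^{α/2} times 𝓕 φ, which is. -/
theorem integrable_rpow_mul_fourier {d : ℕ} {α : ℝ} (hα : 0 ≤ α) (φ : 𝓢(Euc d, ℂ)) :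
    Integrable fun ξ : Euc d =>
      (((2 * Real.pi * ‖ξ‖) ^ α : ℝ) : ℂ) * 𝓕 (φ : Euc d → ℂ) ξ := by
  have hb := (SchwartzMap.smulLeftCLM ℂ (besselSymbol d α) (𝓕 φ)).integrable (μ := volume)
  refine hb.mono ?_ (ae_of_all _ fun ξ => ?_)
  · refine AEStronglyMeasurable.mul ?_ (𝓕 φ).continuous.aestronglyMeasurable
    exact Measurable.aestronglyMeasurable (by fun_prop)
  · rw [SchwartzMap.smulLeftCLM_apply_apply (besselSymbol_hasTemperateGrowth d α), norm_mul,
      smul_eq_mul, norm_mul]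
    gcongr
    · rw [besselSymbol, Complex.norm_real, Complex.norm_real, Real.norm_of_nonneg (by positivity),
        Real.norm_of_nonneg (by positivity)]
      calc (2 * Real.pi * ‖ξ‖) ^ α = ((2 * Real.pi * ‖ξ‖) ^ 2) ^ (α / 2) := by
            rw [← Real.rpow_natCast, ← Real.rpow_mul (by positivity)]
            congr 1; push_cast; ring
        _ ≤ _ := by gcongr; linarith
    · rfl

theorem continuous_fourierInv {d : ℕ} {w : Euc d → ℂ} (hw : Integrable w) :
    Continuous (𝓕⁻ w) := by
  rw [Real.fourierInv_eq_fourier_comp_neg]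
  exact VectorFourier.fourierIntegral_continuous Real.continuous_fourierChar
    (by exact continuous_inner) hw.comp_neg

theorem continuous_fracLaplacian {d : ℕ} {α : ℝ} (hα : 0 ≤ α) (φ : 𝓢(Euc d, ℂ)) :
    Continuous (fracLaplacian α φ) :=
  continuous_fourierInv (integrable_rpow_mul_fourier hα φ)

theorem fourierInv_fourier_schwartz {d : ℕ} (φ : 𝓢(Euc d, ℂ)) (x : Euc d) :
    𝓕⁻ (𝓕 (φ : Euc d → ℂ)) x = φ x := by
  have := Continuous.fourierInv_fourier_eq φ.continuous φ.integrable (𝓕 φ).integrable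
  rw [this]

/-- If `m = ∫ ρ(t) exp(-t|2πξ|²) dt`, the Fourier multiplier `m` is a superposition of the heat
semigroup with weight `ρ`. -/
theorem fourierInv_mul_eq_integral_heatKernel {d : ℕ} {ρ : ℝ → ℝ} (hρ : Measurable ρ)
    (hρ0 : ∀ t, 0 < t → 0 ≤ ρ t) {m : Euc d → ℝ} {w : Euc d → ℂ} (hw : Integrable w)
    (hm : ∀ᵐ ξ : Euc d,
      IntegrableOn (fun t => ρ t * Real.exp (-(t * (2 * Real.pi * ‖ξ‖) ^ 2))) (Set.Ioi 0) ∧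
      ∫ t in Set.Ioi (0 : ℝ), ρ t * Real.exp (-(t * (2 * Real.pi * ‖ξ‖) ^ 2)) = m ξ)
    (hmw : Integrable fun ξ => (m ξ : ℂ) * w ξ) (x : Euc d) :
    𝓕⁻ (fun ξ => (m ξ : ℂ) * w ξ) x = ∫ t in Set.Ioi (0 : ℝ), ∫ y,
      ((ρ t * heatKernel d t (x - y) : ℝ) : ℂ) * 𝓕⁻ w y := by
  let G : Euc d → ℝ → ℂ := fun ξ t => (ρ t : ℂ) * (heatWave d t x ξ * w ξ)
  have hGnorm : ∀ ξ, ∀ t ∈ Set.Ioi (0 : ℝ),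
      ‖G ξ t‖ = ρ t * Real.exp (-(t * (2 * Real.pi * ‖ξ‖) ^ 2)) * ‖w ξ‖ := by
    intro ξ t ht
    rw [norm_mul, norm_mul, norm_heatWave, Complex.norm_real, Real.norm_of_nonneg (hρ0 t ht),
      mul_assoc (ρ t)]
  have hGmeas : AEStronglyMeasurable (Function.uncurry G)
      (volume.prod (volume.restrict (Set.Ioi (0 : ℝ)))) := by
    refine AEStronglyMeasurable.mul (Measurable.aestronglyMeasurable (by fun_prop))
      (AEStronglyMeasurable.mul (Measurable.aestronglyMeasurable ?_) hw.1.comp_fst)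
    unfold heatWave
    fun_prop
  -- Fubini applies because the t-integral of |G| is exactly m|w|, which is integrable by `hmw` even
  -- if `m` is singular.
  have hG : Integrable (Function.uncurry G) (volume.prod (volume.restrict (Set.Ioi (0 : ℝ)))) := by
    rw [integrable_prod_iff hGmeas]
    constructor
    · filter_upwards [hm] with ξ hξ
      refine (hξ.1.mul_const ‖w ξ‖).mono' ?_ ?_
      · simp only [Function.uncurry]
        refine Measurable.aestronglyMeasurable ?_
        unfold G heatWave
        fun_prop
      · filter_upwards [ae_restrict_mem measurableSet_Ioi] with t ht
        exact (hGnorm ξ t ht).le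
    · refine hmw.norm.congr ?_
      filter_upwards [hm] with ξ hξ
      have hm0 : 0 ≤ m ξ := by
        rw [← hξ.2]
        exact setIntegral_nonneg measurableSet_Ioi fun t ht =>
          mul_nonneg (hρ0 t ht) (Real.exp_pos _).le
      simp only [Function.uncurry]
      rw [setIntegral_congr_fun measurableSet_Ioi (hGnorm ξ), integral_mul_const, hξ.2, norm_mul,
        Complex.norm_real, Real.norm_of_nonneg hm0]
  calc 𝓕⁻ (fun ξ => (m ξ : ℂ) * w ξ) x = ∫ ξ, ∫ t in Set.Ioi (0 : ℝ), G ξ t := by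
        rw [Real.fourierInv_eq']
        refine integral_congr_ae ?_
        filter_upwards [hm] with ξ hξ
        have e : ∀ t, G ξ t = ((ρ t * Real.exp (-(t * (2 * Real.pi * ‖ξ‖) ^ 2)) : ℝ) : ℂ) *
            (Complex.exp (2 * Real.pi * inner ℝ ξ x * Complex.I) * w ξ) := by
          intro t
          simp only [G]
          rw [heatWave_eq]
          push_cast
          ring
        simp_rw [e]
        rw [integral_mul_const, integral_complex_ofReal, hξ.2]
        push_cast
        rw [smul_eq_mul]
        ring
    _ = ∫ t in Set.Ioi (0 : ℝ), ∫ ξ, G ξ t := integral_integral_swap hG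
    _ = _ := by
        refine setIntegral_congr_fun measurableSet_Ioi fun t ht => ?_
        simp only [G, Complex.ofReal_mul, mul_assoc]
        rw [integral_const_mul, integral_const_mul, ← integral_heatKernel_mul_fourierInv ht x hw]

theorem enorm_fourierInv_mul_le_lintegral_heatKernel {d : ℕ} {ρ : ℝ → ℝ} (hρ : Measurable ρ)
    (hρ0 : ∀ t, 0 < t → 0 ≤ ρ t) {m : Euc d → ℝ} {w : Euc d → ℂ} (hw : Integrable w)
    (hm : ∀ᵐ ξ : Euc d,
      IntegrableOn (fun t => ρ t * Real.exp (-(t * (2 * Real.pi * ‖ξ‖) ^ 2))) (Set.Ioi 0) ∧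
      ∫ t in Set.Ioi (0 : ℝ), ρ t * Real.exp (-(t * (2 * Real.pi * ‖ξ‖) ^ 2)) = m ξ)
    (hmw : Integrable fun ξ => (m ξ : ℂ) * w ξ) (x : Euc d) :
    ‖𝓕⁻ (fun ξ => (m ξ : ℂ) * w ξ) x‖ₑ ≤ ∫⁻ t in Set.Ioi (0 : ℝ), ∫⁻ y,
      ENNReal.ofReal (ρ t * heatKernel d t (x - y)) * ENNReal.ofReal ‖𝓕⁻ w y‖ := by
  rw [fourierInv_mul_eq_integral_heatKernel hρ hρ0 hw hm hmw]
  refine (enorm_integral_le_lintegral_enorm _).trans ?_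
  refine setLIntegral_mono' measurableSet_Ioi fun t ht => ?_
  refine (enorm_integral_le_lintegral_enorm _).trans ?_
  refine lintegral_mono fun y => ?_
  rw [enorm_mul, ← ofReal_norm, ← ofReal_norm, Complex.norm_real,
    Real.norm_of_nonneg (mul_nonneg (hρ0 t ht) (heatKernel_nonneg ht (x - y)))]

/-- A Schwartz function is dominated by the Riesz potential of `|Δ^{α/2} φ|`. -/
theorem enorm_le_riesz_fracLaplacian {d : ℕ} {α : ℝ} (hd : 1 ≤ d) (hα : 0 < α) (hαd : α < d)
    (φ : 𝓢(Euc d, ℂ)) (x : Euc d) :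
    ‖φ x‖ₑ ≤ ENNReal.ofReal (rieszConst d α) *
      ∫⁻ y, ENNReal.ofReal ‖fracLaplacian α φ y‖ * ENNReal.ofReal (‖x - y‖ ^ (α - d)) := by
  have : Nonempty (Fin d) := ⟨⟨0, hd⟩⟩
  have hΓ := Real.Gamma_pos_of_pos (half_pos hα)
  have hc := rieszConst_pos hα hαd
  have hu := continuous_fracLaplacian hα.le φ
  have hne : ∀ x : Euc d, ∀ᵐ y : Euc d, y ≠ x := fun x => by simp [ae_iff]
  have hcpos : ∀ ξ : Euc d, ξ ≠ 0 → 0 < 2 * Real.pi * ‖ξ‖ := fun ξ hξ => by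
    have := norm_pos_iff.2 hξ
    positivity
  -- The singular symbol |2πξ|^{-α} meets |2πξ|^α and cancels off the null set {0}; this also gives
  -- integrability of the product.
  have hsymb : (fun ξ : Euc d => ((Real.Gamma (α / 2) * (2 * Real.pi * ‖ξ‖) ^ (-α) : ℝ) : ℂ) *
      ((((2 * Real.pi * ‖ξ‖) ^ α : ℝ) : ℂ) * 𝓕 (φ : Euc d → ℂ) ξ)) =ᵐ[volume]
      fun ξ => (Real.Gamma (α / 2) : ℂ) * 𝓕 (φ : Euc d → ℂ) ξ := by
    filter_upwards [hne 0] with ξ hξ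
    rw [← mul_assoc, ← Complex.ofReal_mul, mul_assoc, ← Real.rpow_add (hcpos ξ hξ),
      neg_add_cancel, Real.rpow_zero, mul_one]
  have hinv : 𝓕⁻ (fun ξ : Euc d => ((Real.Gamma (α / 2) * (2 * Real.pi * ‖ξ‖) ^ (-α) : ℝ) : ℂ) *
      ((((2 * Real.pi * ‖ξ‖) ^ α : ℝ) : ℂ) * 𝓕 (φ : Euc d → ℂ) ξ)) x =
      (Real.Gamma (α / 2) : ℂ) * φ x := by
    rw [Real.fourierInv_congr_ae hsymb, ← fourierInv_fourier_schwartz φ x, Real.fourierInv_eq,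
      Real.fourierInv_eq, ← integral_const_mul]
    refine integral_congr_ae (ae_of_all _ fun ξ => ?_)
    simp only [Circle.smul_def, smul_eq_mul]
    ring
  have hle := enorm_fourierInv_mul_le_lintegral_heatKernel
    (ρ := fun t => t ^ (α / 2 - 1)) (by fun_prop) (fun t ht => by positivity)
    (integrable_rpow_mul_fourier hα.le φ)
    (m := fun ξ => Real.Gamma (α / 2) * (2 * Real.pi * ‖ξ‖) ^ (-α))
    (by
      filter_upwards [hne 0] with ξ hξ
      have h1 := integral_rpow_mul_exp_neg_mul hα (hcpos ξ hξ)
      have := hcpos ξ hξ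
      exact ⟨Integrable.of_integral_ne_zero (by rw [h1]; positivity), h1⟩)
    ((((𝓕 φ).integrable (μ := volume)).const_mul (Real.Gamma (α / 2) : ℂ)).congr hsymb.symm) x
  rw [hinv] at hle
  have key : ENNReal.ofReal (Real.Gamma (α / 2)) * ‖φ x‖ₑ ≤
      ENNReal.ofReal (Real.Gamma (α / 2)) * (ENNReal.ofReal (rieszConst d α) *
      ∫⁻ y, ENNReal.ofReal ‖fracLaplacian α φ y‖ * ENNReal.ofReal (‖x - y‖ ^ (α - d))) := by
    calc ENNReal.ofReal (Real.Gamma (α / 2)) * ‖φ x‖ₑ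
        = ‖(Real.Gamma (α / 2) : ℂ) * φ x‖ₑ := by
          rw [enorm_mul, ← ofReal_norm (Real.Gamma (α / 2) : ℂ), Complex.norm_real,
            Real.norm_of_nonneg hΓ.le]
      _ ≤ ∫⁻ t in Set.Ioi (0 : ℝ), ∫⁻ y,
            ENNReal.ofReal (t ^ (α / 2 - 1) * heatKernel d t (x - y)) *
              ENNReal.ofReal ‖fracLaplacian α φ y‖ := hle
      _ = ∫⁻ y, ∫⁻ t in Set.Ioi (0 : ℝ),
            ENNReal.ofReal (t ^ (α / 2 - 1) * heatKernel d t (x - y)) *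
              ENNReal.ofReal ‖fracLaplacian α φ y‖ := by
          refine lintegral_lintegral_swap (Measurable.aemeasurable ?_)
          unfold heatKernel
          have := hu.measurable
          fun_prop
      _ = ∫⁻ y, ENNReal.ofReal (Real.Gamma (α / 2)) * ENNReal.ofReal (rieszConst d α) *
            (ENNReal.ofReal ‖fracLaplacian α φ y‖ * ENNReal.ofReal (‖x - y‖ ^ (α - d))) := by
          refine lintegral_congr_ae ?_
          filter_upwards [hne x] with y hy
          rw [lintegral_mul_const' _ _ ENNReal.ofReal_ne_top,
            lintegral_rpow_mul_heatKernel hα hαd (sub_ne_zero.2 hy.symm),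
            ENNReal.ofReal_mul (by positivity), ENNReal.ofReal_mul hΓ.le]
          ring
      _ = _ := by
          rw [lintegral_const_mul' _ _ (ENNReal.mul_ne_top ENNReal.ofReal_ne_top
            ENNReal.ofReal_ne_top), mul_assoc]
  rwa [ENNReal.mul_le_mul_iff_right (by simpa using hΓ) ENNReal.ofReal_ne_top] at key

/-! ### The Sobolev inequality for Schwartz functions -/

theorem lintegral_norm_rpow_eq {X : Type*} [MeasurableSpace X] {μ : Measure X} {f : X → ℂ}
    {p : ℝ} (hp : 0 < p) :
    ∫⁻ x, ENNReal.ofReal (‖f x‖ ^ p) ∂μ = eLpNorm f (ENNReal.ofReal p) μ ^ p := by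
  rw [eLpNorm_eq_lintegral_rpow_enorm_toReal (by simpa using hp) ENNReal.ofReal_ne_top,
    ENNReal.toReal_ofReal hp.le, ← ENNReal.rpow_mul, one_div_mul_cancel hp.ne', ENNReal.rpow_one]
  refine lintegral_congr fun x => ?_
  rw [← ofReal_norm, ENNReal.ofReal_rpow_of_nonneg (norm_nonneg _) hp.le]

theorem liebBound_pos {d : ℕ} {p q α : ℝ} (he : Exponents d p q α) (hα : 0 < α) :
    0 < liebBound p q d α := by
  have hd := he.dim_pos
  have hp0 := he.holder_p.pos
  have hp0' := he.holder_p.symm.pos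
  have hq0 := he.holder_q.pos
  have hq0' := he.holder_q.symm.pos
  have hV := sphereArea_div_pos d he.one_le_dim
  have hs0 : 0 < 1 - α / d := by rw [← he.conj_add_inv]; positivity
  unfold liebBound
  positivity

theorem EHtilde_pos {d : ℕ} {p q α : ℝ} (he : Exponents d p q α) : 0 < EHtilde p q d := by
  rcases he.nonneg_order.eq_or_lt with h | h
  · subst h
    rw [EHtilde_eq_one he]
    exact one_pos
  · rw [EHtilde_eq _ _ _ (by rwa [he.order_eq]), he.order_eq]
    exact mul_pos (rieszConst_pos h he.order_lt_dim) (liebBound_pos he h)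

/-- The Sobolev inequality with constant `EHtilde`, for Schwartz functions and `α > 0`. -/
theorem eLpNorm_le_EHtilde_of_pos {d : ℕ} {p q α : ℝ} (he : Exponents d p q α) (hα : 0 < α)
    (φ : 𝓢(Euc d, ℂ)) :
    eLpNorm φ (ENNReal.ofReal q) ≤
      ENNReal.ofReal (EHtilde p q d) * eLpNorm (fracLaplacian α φ) (ENNReal.ofReal p) := by
  have hK := EHtilde_pos he
  have hp0 := he.holder_p.pos
  have hq0 := he.holder_q.pos
  have hq0' := he.holder_q.symm.pos
  have hq1 : 0 < q - 1 := he.holder_q.sub_one_pos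
  have hqq : (q - 1) * q.conjExponent = q := he.holder_q.sub_one_mul_conj
  have hu := continuous_fracLaplacian hα.le φ
  have hφ := φ.continuous
  set N := eLpNorm (fracLaplacian α φ) (ENNReal.ofReal p) volume with hN
  set M := eLpNorm φ (ENNReal.ofReal q) volume with hM
  rcases eq_or_ne N ⊤ with hNT | hNT
  · rw [hNT, ENNReal.mul_top (by simpa using hK)]; exact le_top
  rcases eq_or_ne M 0 with hM0 | hM0
  · rw [hM0]; exact zero_le
  have hMT : M ≠ ⊤ := (φ.memLp (ENNReal.ofReal q) volume).2.ne
  set m := M.toReal with hm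
  have hm0 : 0 < m := ENNReal.toReal_pos hM0 hMT
  have hMm : M = ENNReal.ofReal m := (ENNReal.ofReal_toReal hMT).symm
  -- Any `A` above the norm is used in place of the norm itself, since the Hardy-Littlewood-Sobolev
  -- inequality above wants positive bounds and `N` could a priori vanish; `A` is sent to the norm
  -- at the end.
  have step : ∀ A : ℝ, N.toReal < A → m ≤ EHtilde p q d * A := by
    intro A hA
    have hA0 : 0 < A := ENNReal.toReal_nonneg.trans_lt hA
    have h1 : ∫⁻ x, ENNReal.ofReal (‖fracLaplacian α φ x‖ ^ p) ≤ ENNReal.ofReal (A ^ p) := by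
      rw [lintegral_norm_rpow_eq hp0, ← hN, ← ENNReal.ofReal_rpow_of_pos hA0]
      gcongr
      rw [← ENNReal.ofReal_toReal hNT]
      exact ENNReal.ofReal_le_ofReal hA.le
    -- |φ|^{q-1} is the extremal dual function: its L^{q'} norm is m^{q-1} because (q-1)q' = q.
    -- Dividing m^q by m^{q-1} later is legitimate since m is finite and positive.
    have h2 : ∫⁻ x, ENNReal.ofReal ((‖φ x‖ ^ (q - 1)) ^ q.conjExponent) ≤
        ENNReal.ofReal ((m ^ (q - 1)) ^ q.conjExponent) := by
      simp_rw [← Real.rpow_mul (norm_nonneg _), ← Real.rpow_mul hm0.le, hqq]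
      rw [lintegral_norm_rpow_eq hq0, ← hM, hMm, ENNReal.ofReal_rpow_of_pos hm0]
    have key := hardyLittlewoodSobolev he hα hu.norm.measurable (fun x => norm_nonneg _)
      (h := fun x => ‖φ x‖ ^ (q - 1)) (by fun_prop) (fun x => by positivity) hA0
      (Real.rpow_pos_of_pos hm0 (q - 1)) h1 h2
    have hc := rieszConst_pos hα he.order_lt_dim
    have hk := measurable_riesz d α
    have e : ENNReal.ofReal (m ^ q) ≤
        ENNReal.ofReal (rieszConst d α * (liebBound p q d α * A * m ^ (q - 1))) := by
      calc ENNReal.ofReal (m ^ q)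
          = ∫⁻ x, ENNReal.ofReal (‖φ x‖ ^ q) := by
            rw [lintegral_norm_rpow_eq hq0, ← hM, hMm, ENNReal.ofReal_rpow_of_pos hm0]
        _ ≤ ∫⁻ x, ENNReal.ofReal (rieszConst d α) * ∫⁻ y, ENNReal.ofReal ‖fracLaplacian α φ y‖ *
              (ENNReal.ofReal (‖φ x‖ ^ (q - 1)) * ENNReal.ofReal (‖x - y‖ ^ (α - d))) := by
            refine lintegral_mono fun x => ?_
            have h3 := enorm_le_riesz_fracLaplacian he.one_le_dim hα he.order_lt_dim φ x
            calc ENNReal.ofReal (‖φ x‖ ^ q)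
                ≤ ENNReal.ofReal (‖φ x‖ ^ (q - 1)) * ‖φ x‖ₑ := by
                  rw [← ofReal_norm, ← ENNReal.ofReal_mul (by positivity)]
                  refine ENNReal.ofReal_le_ofReal (le_of_eq ?_)
                  rw [← Real.rpow_add_one' (norm_nonneg _) (by linarith), sub_add_cancel]
              _ ≤ ENNReal.ofReal (‖φ x‖ ^ (q - 1)) * _ := mul_le_mul_right h3 _
              _ = _ := by
                  rw [mul_left_comm, ← lintegral_const_mul' _ _ ENNReal.ofReal_ne_top]
                  congr 1
                  refine lintegral_congr fun y => ?_
                  ring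
        _ = ENNReal.ofReal (rieszConst d α) * ∫⁻ y, ENNReal.ofReal ‖fracLaplacian α φ y‖ *
              ∫⁻ x, ENNReal.ofReal (‖φ x‖ ^ (q - 1)) * ENNReal.ofReal (‖y - x‖ ^ (α - d)) := by
            rw [lintegral_const_mul' _ _ ENNReal.ofReal_ne_top, lintegral_lintegral_swap]
            · congr 1
              refine lintegral_congr fun y => ?_
              rw [lintegral_const_mul' _ _ ENNReal.ofReal_ne_top]
              simp_rw [norm_sub_rev y]
            · refine Measurable.aemeasurable (Measurable.mul ?_ (Measurable.mul ?_ hk))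
              · exact (hu.norm.measurable.comp measurable_snd).ennreal_ofReal
              · exact ((hφ.norm.measurable.comp measurable_fst).pow_const _).ennreal_ofReal
        _ ≤ _ := by
            rw [ENNReal.ofReal_mul hc.le]
            gcongr
    have hl := liebBound_pos he hα
    rw [ENNReal.ofReal_le_ofReal_iff (by positivity)] at e
    have e2 : m ^ q = m * m ^ (q - 1) := by
      rw [Real.rpow_sub_one hm0.ne']; field_simp
    rw [EHtilde_eq _ _ _ (by rwa [he.order_eq]), he.order_eq]
    refine le_of_mul_le_mul_right ?_ (Real.rpow_pos_of_pos hm0 (q - 1))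
    rw [← e2]
    refine e.trans_eq ?_
    ring
  have hlim : m ≤ EHtilde p q d * N.toReal := by
    refine le_of_forall_pos_le_add fun ε hε => ?_
    have := step (N.toReal + ε / EHtilde p q d) (by linarith [div_pos hε hK])
    rwa [mul_add, mul_div_cancel₀ _ hK.ne'] at this
  rw [hMm, ← ENNReal.ofReal_toReal hNT, ← ENNReal.ofReal_mul hK.le]
  exact ENNReal.ofReal_le_ofReal hlim

theorem fracLaplacian_zero {d : ℕ} (φ : 𝓢(Euc d, ℂ)) : fracLaplacian 0 φ = φ := by
  funext x
  rw [fracLaplacian]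
  simp only [Real.rpow_zero, Complex.ofReal_one, one_mul]
  exact fourierInv_fourier_schwartz φ x

/-- The Sobolev inequality with constant `EHtilde`, for Schwartz functions. -/
theorem eLpNorm_le_EHtilde {d : ℕ} {p q α : ℝ} (he : Exponents d p q α) (φ : 𝓢(Euc d, ℂ)) :
    eLpNorm φ (ENNReal.ofReal q) ≤
      ENNReal.ofReal (EHtilde p q d) * eLpNorm (fracLaplacian α φ) (ENNReal.ofReal p) := by
  rcases he.nonneg_order.eq_or_lt with h | h
  · subst h
    have hpq : q = p := by
      have := he.inv_q
      simpa using this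
    rw [EHtilde_eq_one he, fracLaplacian_zero, hpq, ENNReal.ofReal_one, one_mul]
  · exact eLpNorm_le_EHtilde_of_pos he h φ

/-! ### Limits in `L^p` -/

theorem exists_memLp_tendsto_of_cauchy {X : Type*} [MeasurableSpace X] {μ : Measure X}
    {r : ℝ≥0∞} (hr : 1 ≤ r) {u : ℕ → X → ℂ} (hu : ∀ n, MemLp (u n) r μ) {C : ℝ≥0∞} (hC : C ≠ ⊤)
    {e : ℕ → ℝ≥0∞} (he : Tendsto e atTop (𝓝 0))
    (h : ∀ n m, eLpNorm (u n - u m) r μ ≤ C * (e n + e m)) :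
    ∃ f : X → ℂ, MemLp f r μ ∧ Tendsto (fun n => eLpNorm (u n - f) r μ) atTop (𝓝 0) := by
  have : Fact (1 ≤ r) := ⟨hr⟩
  have hcs : CauchySeq fun n => (hu n).toLp (u n) := by
    rw [EMetric.cauchySeq_iff]
    intro ε hε
    have hlim : Tendsto (fun n => C * e n) atTop (𝓝 0) := by
      have := ENNReal.Tendsto.const_mul he (Or.inr hC)
      rwa [mul_zero] at this
    obtain ⟨N, hN⟩ := eventually_atTop.1 (hlim.eventually_lt_const (ENNReal.half_pos hε.ne'))
    refine ⟨N, fun m hm n hn => ?_⟩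
    rw [Lp.edist_toLp_toLp]
    calc eLpNorm (u m - u n) r μ ≤ C * (e m + e n) := h m n
      _ = C * e m + C * e n := mul_add _ _ _
      _ < ε / 2 + ε / 2 := ENNReal.add_lt_add (hN m hm) (hN n hn)
      _ = ε := ENNReal.add_halves ε
  obtain ⟨f, hf⟩ := cauchySeq_tendsto_of_complete hcs
  refine ⟨f, Lp.memLp f, ?_⟩
  rw [Lp.tendsto_Lp_iff_tendsto_eLpNorm'] at hf
  refine hf.congr fun n => eLpNorm_congr_ae ?_
  filter_upwards [(hu n).coeFn_toLp] with x hx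
  simp [hx]

theorem eLpNorm_le_of_tendsto {X : Type*} [MeasurableSpace X] {μ : Measure X}
    {r : ℝ≥0∞} (hr : 1 ≤ r) {u : ℕ → X → ℂ} (hu : ∀ n, AEStronglyMeasurable (u n) μ) {f : X → ℂ}
    (hf : AEStronglyMeasurable f μ)
    (hlim : Tendsto (fun n => eLpNorm (u n - f) r μ) atTop (𝓝 0)) {b : ℕ → ℝ≥0∞} {B : ℝ≥0∞}
    (hb : Tendsto b atTop (𝓝 B)) (h : ∀ n, eLpNorm (u n) r μ ≤ b n) :
    eLpNorm f r μ ≤ B := by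
  have h1 : Tendsto (fun n => b n + eLpNorm (u n - f) r μ) atTop (𝓝 (B + 0)) := hb.add hlim
  rw [add_zero] at h1
  refine ge_of_tendsto' h1 fun n => ?_
  calc eLpNorm f r μ = eLpNorm (u n - (u n - f)) r μ := by rw [sub_sub_cancel]
    _ ≤ eLpNorm (u n) r μ + eLpNorm (u n - f) r μ := eLpNorm_sub_le (hu n) ((hu n).sub hf) hr
    _ ≤ _ := by gcongr; exact h n

theorem tendsto_toTemperedDistribution {d : ℕ} {r : ℝ≥0∞} (hr : 1 ≤ r) {φ : ℕ → 𝓢(Euc d, ℂ)}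
    {f : Euc d → ℂ} (hf : MemLp f r)
    (hlim : Tendsto (fun n => eLpNorm ((φ n : Euc d → ℂ) - f) r) atTop (𝓝 0)) :
    ∃ T : 𝓢'(Euc d, ℂ), Represents T f ∧
      Tendsto (fun n => SchwartzMap.toTemperedDistributionCLM (Euc d) ℂ volume (φ n))
        atTop (𝓝 T) := by
  have : Fact (1 ≤ r) := ⟨hr⟩
  refine ⟨Lp.toTemperedDistribution (hf.toLp f), fun ψ => ?_, ?_⟩
  · rw [Lp.toTemperedDistribution_apply]
    refine integral_congr_ae ?_
    filter_upwards [hf.coeFn_toLp] with x hx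
    rw [hx, smul_eq_mul]
  · have h1 : Tendsto (fun n => (φ n).toLp r volume) atTop (𝓝 (hf.toLp f)) := by
      rw [Lp.tendsto_Lp_iff_tendsto_eLpNorm']
      refine hlim.congr fun n => eLpNorm_congr_ae ?_
      filter_upwards [hf.coeFn_toLp, (φ n).coeFn_toLp r volume] with x hx hy
      simp [hx, hy]
    have h2 := ((Lp.toTemperedDistributionCLM ℂ (volume : Measure (Euc d)) r).continuous.tendsto
      (hf.toLp f)).comp h1
    simpa [Function.comp_def] using h2

theorem represents_unique {d : ℕ} {T S : 𝓢'(Euc d, ℂ)} {f : Euc d → ℂ} (hT : Represents T f)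
    (hS : Represents S f) : T = S := by
  ext ψ
  rw [hT ψ, hS ψ]

/-! ### The homogeneous embedding -/

theorem fracLaplacian_sub {d : ℕ} {α : ℝ} (hα : 0 ≤ α) (φ ψ : 𝓢(Euc d, ℂ)) :
    fracLaplacian α (φ - ψ) = fracLaplacian α φ - fracLaplacian α ψ := by
  have h1 := integrable_rpow_mul_fourier hα φ
  have h2 := integrable_rpow_mul_fourier hα ψ
  funext x
  have e : 𝓕 ((φ - ψ : 𝓢(Euc d, ℂ)) : Euc d → ℂ) = 𝓕 (φ : Euc d → ℂ) - 𝓕 (ψ : Euc d → ℂ) := by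
    rw [← SchwartzMap.fourier_coe, ← FourierTransform.fourierCLM_apply (R := ℂ), map_sub]
    rfl
  rw [Pi.sub_apply, fracLaplacian, fracLaplacian, fracLaplacian, Real.fourierInv_eq,
    Real.fourierInv_eq, Real.fourierInv_eq, ← integral_sub]
  · refine integral_congr_ae (ae_of_all _ fun ξ => ?_)
    simp only [e, Pi.sub_apply, mul_sub, smul_sub]
  · have := (Real.fourierIntegral_convergent_iff (-x)).2 h1
    simpa using this
  · have := (Real.fourierIntegral_convergent_iff (-x)).2 h2
    simpa using this

/-- The bound applied to differences makes the approximating sequence Cauchy in L^q, and the bound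
passes to the limit. -/
theorem exists_represents_of_schwartz_bound {d : ℕ} {p q : ℝ≥0∞} (hp : 1 ≤ p) (hq : 1 ≤ q) {α : ℝ}
    (hα : 0 ≤ α) {K : ℝ≥0∞} (hK : K ≠ ⊤)
    (hbound : ∀ φ : 𝓢(Euc d, ℂ), eLpNorm φ q volume ≤ K * eLpNorm (fracLaplacian α φ) p volume)
    {T : 𝓢'(Euc d, ℂ)} {φ : ℕ → 𝓢(Euc d, ℂ)} {g : Euc d → ℂ} (hg : MemLp g p)
    (hφT : Tendsto (fun n => SchwartzMap.toTemperedDistributionCLM (Euc d) ℂ volume (φ n))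
      atTop (𝓝 T))
    (hφg : Tendsto (fun n => eLpNorm (fracLaplacian α (φ n) - g) p) atTop (𝓝 0)) :
    ∃ f : Euc d → ℂ, MemLp f q ∧ Represents T f ∧ eLpNorm f q ≤ K * eLpNorm g p := by
  have hm : ∀ n, AEStronglyMeasurable (fracLaplacian α (φ n)) :=
    fun n => (continuous_fracLaplacian hα (φ n)).aestronglyMeasurable
  have hmq : ∀ n, MemLp (φ n) q volume := fun n => (φ n).memLp _ _
  have hcau : ∀ n m, eLpNorm ((φ n : Euc d → ℂ) - (φ m : Euc d → ℂ)) q volume ≤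
      K * (eLpNorm (fracLaplacian α (φ n) - g) p volume +
        eLpNorm (fracLaplacian α (φ m) - g) p volume) := by
    intro n m
    refine (hbound (φ n - φ m)).trans ?_
    gcongr
    rw [fracLaplacian_sub hα, ← sub_sub_sub_cancel_right (fracLaplacian α (φ n)) _ g]
    exact eLpNorm_sub_le ((hm n).sub hg.1) ((hm m).sub hg.1) hp
  obtain ⟨f, hf, hlim⟩ := exists_memLp_tendsto_of_cauchy hq hmq hK hφg hcau
  obtain ⟨S, hS, hφS⟩ := tendsto_toTemperedDistribution hq hf hlim
  -- Convergence in L^q implies convergence as tempered distributions, so the L^q limit is the given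
  -- `T`.
  have hST : T = S := tendsto_nhds_unique hφT hφS
  refine ⟨f, hf, hST ▸ hS, ?_⟩
  have hb : Tendsto (fun n => K * (eLpNorm (fracLaplacian α (φ n) - g) p volume +
      eLpNorm g p volume)) atTop (𝓝 (K * (0 + eLpNorm g p volume))) :=
    ENNReal.Tendsto.const_mul (hφg.add tendsto_const_nhds) (Or.inr hK)
  rw [zero_add] at hb
  refine eLpNorm_le_of_tendsto hq (fun n => (hmq n).1) hf.1 hlim hb fun n => ?_
  have htri := eLpNorm_add_le ((hm n).sub hg.1) hg.1 hp
  rw [sub_add_cancel] at htri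
  exact (hbound (φ n)).trans (mul_le_mul_right htri K)

namespace Exponents

variable {d : ℕ} {p q α : ℝ} (he : Exponents d p q α)
include he

theorem one_le_ofReal_p : 1 ≤ ENNReal.ofReal p :=
  ENNReal.one_le_ofReal.2 he.one_lt_p.le

theorem one_le_ofReal_q : 1 ≤ ENNReal.ofReal q :=
  ENNReal.one_le_ofReal.2 he.one_lt_q.le

end Exponents

theorem EH_le_EHtilde {d : ℕ} {p q α : ℝ} (he : Exponents d p q α) :
    EH p q d ≤ ENNReal.ofReal (EHtilde p q d) := by
  refine sInf_le ?_
  rintro T N ⟨φ, g, hg, hφT, hφg, rfl⟩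
  rw [he.order_eq] at hφg
  exact exists_represents_of_schwartz_bound he.one_le_ofReal_p he.one_le_ofReal_q
    he.nonneg_order ENNReal.ofReal_ne_top (eLpNorm_le_EHtilde he) hg hφT hφg

/-! ### The binomial series of `(1 - y)^s` -/

/-- The Taylor coefficients of `(1 - y)^s`. -/
def binomCoeff (s : ℝ) (k : ℕ) : ℝ := (-1) ^ k * Ring.choose s k

theorem binomCoeff_zero (s : ℝ) : binomCoeff s 0 = 1 := by simp [binomCoeff]

theorem binomCoeff_succ (s : ℝ) (k : ℕ) :
    (k + 1) * binomCoeff s (k + 1) = (k - s) * binomCoeff s k := by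
  have h : (k + 1) * Ring.choose s (k + 1) = (s - k) * Ring.choose s k := by
    rw [Ring.choose_eq_smul, Ring.choose_eq_smul, descPochhammer_succ_right,
      Polynomial.smeval_mul, Polynomial.smeval_sub, Polynomial.smeval_X,
      Polynomial.smeval_natCast, Nat.factorial_succ]
    have := Nat.factorial_ne_zero k
    simp only [smul_eq_mul]
    push_cast
    field_simp
    simp
  rw [binomCoeff, binomCoeff, pow_succ]
  linear_combination -(-1 : ℝ) ^ k * h

/-- The first coefficient is -s, and the recurrence factor k - s is nonnegative for k ≥ 1. -/
theorem binomCoeff_succ_nonpos {s : ℝ} (hs0 : 0 ≤ s) (hs1 : s ≤ 1) (k : ℕ) :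
    binomCoeff s (k + 1) ≤ 0 := by
  induction k with
  | zero =>
    have := binomCoeff_succ s 0
    simp only [binomCoeff_zero] at this
    norm_num at this
    rw [zero_add, this]
    linarith
  | succ k ih =>
    have := binomCoeff_succ s (k + 1)
    push_cast at this
    have hk : (0 : ℝ) ≤ k := k.cast_nonneg
    nlinarith

theorem hasSum_binomCoeff (s : ℝ) {y : ℝ} (hy0 : 0 ≤ y) (hy1 : y < 1) :
    HasSum (fun k => binomCoeff s k * y ^ k) ((1 - y) ^ s) := by
  have h := (Real.one_add_rpow_hasFPowerSeriesOnBall_zero (a := s)).hasSum (y := -y) (by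
    rw [← ENNReal.ofReal_one, Metric.eball_ofReal]
    simpa [abs_of_nonneg hy0] using hy1)
  rw [zero_add, ← sub_eq_add_neg] at h
  refine h.congr_fun fun k => ?_
  rw [binomialSeries_apply, binomCoeff, List.prod_ofFn, Finset.prod_const, Finset.card_univ,
    Fintype.card_fin, neg_pow y, smul_eq_mul]
  ring

/-- Only the zeroth coefficient is positive, so for y < 1 the series of absolute values sums to 2 -
(1-y)^s ≤ 2; then y tends to 1 in a finite partial sum. -/
theorem sum_abs_binomCoeff_le {s : ℝ} (hs0 : 0 ≤ s) (hs1 : s ≤ 1) (n : ℕ) :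
    ∑ k ∈ Finset.range n, |binomCoeff s k| ≤ 2 := by
  have key : ∀ y : ℝ, 0 ≤ y → y < 1 → ∑ k ∈ Finset.range n, |binomCoeff s k| * y ^ k ≤ 2 := by
    intro y hy0 hy1
    have h := hasSum_binomCoeff s hy0 hy1
    have h1 : HasSum (fun k => 2 * (if k = 0 then 1 else 0) - binomCoeff s k * y ^ k)
        (2 * 1 - (1 - y) ^ s) := ((hasSum_ite_eq 0 (1 : ℝ)).mul_left 2).sub h
    have e : ∀ k, 2 * (if k = 0 then 1 else 0) - binomCoeff s k * y ^ k =
        |binomCoeff s k| * y ^ k := by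
      rintro (_ | k)
      · norm_num [binomCoeff_zero]
      · simp [abs_of_nonpos (binomCoeff_succ_nonpos hs0 hs1 k)]
    simp_rw [e] at h1
    refine (sum_le_hasSum _ (fun k _ => by positivity) h1).trans ?_
    have : 0 ≤ (1 - y) ^ s := Real.rpow_nonneg (by linarith) s
    linarith
  have hlim : Tendsto (fun y : ℝ => ∑ k ∈ Finset.range n, |binomCoeff s k| * y ^ k) (𝓝[<] 1)
      (𝓝 (∑ k ∈ Finset.range n, |binomCoeff s k| * 1 ^ k)) := by
    refine Tendsto.mono_left (Continuous.tendsto ?_ 1) nhdsWithin_le_nhds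
    fun_prop
  simp only [one_pow, mul_one] at hlim
  refine le_of_tendsto hlim ?_
  filter_upwards [Ioo_mem_nhdsLT (show (0 : ℝ) < 1 by norm_num)] with y hy
  exact key y hy.1.le hy.2

theorem summable_abs_binomCoeff {s : ℝ} (hs0 : 0 ≤ s) (hs1 : s ≤ 1) :
    Summable fun k => |binomCoeff s k| :=
  summable_of_sum_range_le (fun _ => abs_nonneg _) (sum_abs_binomCoeff_le hs0 hs1)

/-! ### The resolvent of the Laplacian is a contraction of `L^p` -/

theorem rpow_lintegral_le {Ω : Type*} [MeasurableSpace Ω] {ν : Measure Ω} [IsProbabilityMeasure ν]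
    {p : ℝ} (hp : 1 ≤ p) {f : Ω → ℝ≥0∞} (hf : AEMeasurable f ν) :
    (∫⁻ ω, f ω ∂ν) ^ p ≤ ∫⁻ ω, f ω ^ p ∂ν := by
  have hp0 : 0 < p := by linarith
  rcases hp.eq_or_lt with rfl | h1
  · simp
  have h := ENNReal.lintegral_mul_le_Lp_mul_Lq ν (Real.HolderConjugate.conjExponent h1) hf
    (aemeasurable_const (b := (1 : ℝ≥0∞)))
  simp only [Pi.mul_apply, mul_one, ENNReal.one_rpow, lintegral_const, measure_univ] at h
  calc (∫⁻ ω, f ω ∂ν) ^ p ≤ ((∫⁻ ω, f ω ^ p ∂ν) ^ (1 / p)) ^ p := by gcongr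
    _ = _ := by rw [← ENNReal.rpow_mul, one_div_mul_cancel hp0.ne', ENNReal.rpow_one]

/-- Averaging over a probability measure does not increase the `L^p` norm. -/
theorem lintegral_rpow_lintegral_le {X Ω : Type*} [MeasurableSpace X] [MeasurableSpace Ω]
    {μ : Measure X} [SFinite μ] {ν : Measure Ω} [IsProbabilityMeasure ν] {p : ℝ} (hp : 1 ≤ p)
    {F : X → Ω → ℝ≥0∞} (hF : Measurable (Function.uncurry F)) {N : ℝ≥0∞}
    (hN : ∀ ω, ∫⁻ x, F x ω ^ p ∂μ ≤ N) :
    ∫⁻ x, (∫⁻ ω, F x ω ∂ν) ^ p ∂μ ≤ N := by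
  calc ∫⁻ x, (∫⁻ ω, F x ω ∂ν) ^ p ∂μ ≤ ∫⁻ x, ∫⁻ ω, F x ω ^ p ∂ν ∂μ :=
        lintegral_mono fun x => rpow_lintegral_le hp (hF.comp measurable_prodMk_left).aemeasurable
    _ = ∫⁻ ω, ∫⁻ x, F x ω ^ p ∂μ ∂ν := lintegral_lintegral_swap (hF.pow_const p).aemeasurable
    _ ≤ ∫⁻ _, N ∂ν := lintegral_mono hN
    _ = N := by simp

theorem integral_exp_neg_mul_exp_neg (c : ℝ) :
    IntegrableOn (fun t : ℝ => Real.exp (-t) * Real.exp (-(t * c ^ 2))) (Set.Ioi 0) ∧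
      ∫ t in Set.Ioi (0 : ℝ), Real.exp (-t) * Real.exp (-(t * c ^ 2)) = 1 / (1 + c ^ 2) := by
  have hneg : -(1 + c ^ 2) < 0 := by nlinarith [sq_nonneg c]
  have e : ∀ t : ℝ, Real.exp (-t) * Real.exp (-(t * c ^ 2)) = Real.exp (-(1 + c ^ 2) * t) :=
    fun t => by rw [← Real.exp_add]; congr 1; ring
  simp_rw [e]
  refine ⟨integrableOn_exp_mul_Ioi hneg 0, ?_⟩
  rw [integral_exp_mul_Ioi hneg 0, mul_zero, Real.exp_zero, neg_div_neg_eq]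

/-- The resolvent `(I + Δ)⁻¹` on Schwartz functions. -/
def resolvent (d : ℕ) : 𝓢(Euc d, ℂ) →L[ℂ] 𝓢(Euc d, ℂ) :=
  SchwartzMap.fourierMultiplierCLM ℂ (besselSymbol d (-2))

theorem fourier_fourierMultiplierCLM {d : ℕ} {g : Euc d → ℂ} (hg : g.HasTemperateGrowth)
    (ψ : 𝓢(Euc d, ℂ)) (ξ : Euc d) :
    𝓕 (SchwartzMap.fourierMultiplierCLM ℂ g ψ : Euc d → ℂ) ξ = g ξ * 𝓕 (ψ : Euc d → ℂ) ξ := by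
  rw [← SchwartzMap.fourier_coe, SchwartzMap.fourierMultiplierCLM_apply,
    FourierTransform.fourier_fourierInv_eq, SchwartzMap.smulLeftCLM_apply_apply hg, smul_eq_mul]
  rfl

theorem besselSymbol_neg_two (d : ℕ) (ξ : Euc d) :
    besselSymbol d (-2) ξ = ((1 / (1 + (2 * Real.pi * ‖ξ‖) ^ 2) : ℝ) : ℂ) := by
  rw [besselSymbol, show (-2 : ℝ) / 2 = -1 by norm_num, Real.rpow_neg_one, one_div]

theorem fourier_resolvent {d : ℕ} (ψ : 𝓢(Euc d, ℂ)) (ξ : Euc d) :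
    𝓕 (resolvent d ψ : Euc d → ℂ) ξ =
      ((1 / (1 + (2 * Real.pi * ‖ξ‖) ^ 2) : ℝ) : ℂ) * 𝓕 (ψ : Euc d → ℂ) ξ := by
  rw [resolvent, fourier_fourierMultiplierCLM (besselSymbol_hasTemperateGrowth d _),
    besselSymbol_neg_two]

/-- From 1/(1+λ) = ∫ e^{-t} e^{-tλ} dt: the resolvent is the Laplace transform of the heat
semigroup. -/
theorem enorm_resolvent_le {d : ℕ} (ψ : 𝓢(Euc d, ℂ)) (x : Euc d) :
    ‖resolvent d ψ x‖ₑ ≤ ∫⁻ t in Set.Ioi (0 : ℝ), ∫⁻ z,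
      ENNReal.ofReal (Real.exp (-t) * heatKernel d t z) * ENNReal.ofReal ‖ψ (x - z)‖ := by
  have hF : (fun ξ : Euc d => ((1 / (1 + (2 * Real.pi * ‖ξ‖) ^ 2) : ℝ) : ℂ) *
      𝓕 (ψ : Euc d → ℂ) ξ) = 𝓕 (resolvent d ψ : Euc d → ℂ) :=
    funext fun ξ => (fourier_resolvent ψ ξ).symm
  have h := enorm_fourierInv_mul_le_lintegral_heatKernel (ρ := fun t => Real.exp (-t))
    (by fun_prop) (fun t _ => (Real.exp_pos _).le) ((𝓕 ψ).integrable (μ := volume))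
    (ae_of_all _ fun ξ : Euc d => integral_exp_neg_mul_exp_neg (2 * Real.pi * ‖ξ‖))
    (by
      have := (𝓕 (resolvent d ψ)).integrable (μ := volume)
      refine this.congr (ae_of_all _ fun ξ => ?_)
      exact fourier_resolvent ψ ξ) x
  simp_rw [SchwartzMap.fourier_coe] at h
  rw [hF, fourierInv_fourier_schwartz] at h
  refine h.trans_eq ?_
  refine lintegral_congr fun t => ?_
  rw [← lintegral_sub_left_eq_self _ x]
  simp_rw [sub_sub_cancel, fourierInv_fourier_schwartz]

/-- The law of the position at an exponential time of the diffusion generated by `-Δ`. -/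
def resolventMeasure (d : ℕ) : Measure (ℝ × Euc d) :=
  ((volume.restrict (Set.Ioi (0 : ℝ))).prod volume).withDensity
    fun z => ENNReal.ofReal (Real.exp (-z.1) * heatKernel d z.1 z.2)

theorem measurable_resolventDensity (d : ℕ) : Measurable fun z : ℝ × Euc d =>
    ENNReal.ofReal (Real.exp (-z.1) * heatKernel d z.1 z.2) := by
  unfold heatKernel
  fun_prop

instance (d : ℕ) : IsProbabilityMeasure (resolventMeasure d) where
  measure_univ := by
    rw [resolventMeasure, withDensity_apply _ MeasurableSet.univ, Measure.restrict_univ,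
      lintegral_prod _ (measurable_resolventDensity d).aemeasurable]
    calc ∫⁻ t in Set.Ioi (0 : ℝ), ∫⁻ z, ENNReal.ofReal (Real.exp (-t) * heatKernel d t z)
        = ∫⁻ t in Set.Ioi (0 : ℝ), ENNReal.ofReal (Real.exp (-t)) := by
          refine setLIntegral_congr_fun measurableSet_Ioi fun t ht => ?_
          simp_rw [ENNReal.ofReal_mul (Real.exp_pos (-t)).le]
          rw [lintegral_const_mul' _ _ ENNReal.ofReal_ne_top,
            ← ofReal_integral_eq_lintegral_ofReal (integrable_heatKernel ht)
              (ae_of_all _ (heatKernel_nonneg ht)), integral_heatKernel ht, ENNReal.ofReal_one,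
            mul_one]
      _ = 1 := by
          rw [← ofReal_integral_eq_lintegral_ofReal, integral_exp_neg_Ioi_zero, ENNReal.ofReal_one]
          · exact integrableOn_exp_neg_Ioi 0
          · exact ae_of_all _ fun t => (Real.exp_pos _).le

/-- |(I+Δ)⁻¹ψ| is at most an average of translates of |ψ| over a probability measure; Jensen and
translation invariance conclude. -/
theorem eLpNorm_resolvent_le {d : ℕ} {p : ℝ} (hp : 1 ≤ p) (ψ : 𝓢(Euc d, ℂ)) :
    eLpNorm (resolvent d ψ) (ENNReal.ofReal p) volume ≤ eLpNorm ψ (ENNReal.ofReal p) volume := by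
  have hp0 : 0 < p := by linarith
  have hψ := ψ.continuous.measurable
  have hle : ∀ x, ‖resolvent d ψ x‖ₑ ≤
      ∫⁻ z, ENNReal.ofReal ‖ψ (x - z.2)‖ ∂(resolventMeasure d) := by
    intro x
    have hm : Measurable fun z : ℝ × Euc d => ENNReal.ofReal ‖ψ (x - z.2)‖ := by fun_prop
    rw [resolventMeasure, lintegral_withDensity_eq_lintegral_mul _ (measurable_resolventDensity d)
      hm, lintegral_prod _ ((measurable_resolventDensity d).mul hm).aemeasurable]
    exact enorm_resolvent_le ψ x
  rw [← ENNReal.rpow_le_rpow_iff hp0, ← lintegral_norm_rpow_eq hp0, ← lintegral_norm_rpow_eq hp0]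
  calc ∫⁻ x, ENNReal.ofReal (‖resolvent d ψ x‖ ^ p)
      ≤ ∫⁻ x, (∫⁻ z, ENNReal.ofReal ‖ψ (x - z.2)‖ ∂(resolventMeasure d)) ^ p := by
        refine lintegral_mono fun x => ?_
        rw [← ENNReal.ofReal_rpow_of_nonneg (norm_nonneg _) hp0.le, ofReal_norm]
        gcongr
        exact hle x
    _ ≤ _ := by
        refine lintegral_rpow_lintegral_le hp ?_ fun z => ?_
        · have : Measurable fun y : Euc d × ℝ × Euc d => ψ (y.1 - y.2.2) := by fun_prop
          exact this.norm.ennreal_ofReal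
        · rw [lintegral_sub_right_eq_self (fun x => ENNReal.ofReal ‖ψ x‖ ^ p) z.2]
          refine le_of_eq (lintegral_congr fun x => ?_)
          rw [ENNReal.ofReal_rpow_of_nonneg (norm_nonneg _) hp0.le]

/-! ### The multiplier `(Δ (I + Δ)⁻¹)^s` -/

/-- The symbol `λ / (1 + λ)`, `λ = |2πξ|²`, of `Δ (I + Δ)⁻¹`. -/
def ratioSymbol (d : ℕ) (ξ : Euc d) : ℝ :=
  (2 * Real.pi * ‖ξ‖) ^ 2 / (1 + (2 * Real.pi * ‖ξ‖) ^ 2)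

theorem ratioSymbol_nonneg {d : ℕ} (ξ : Euc d) : 0 ≤ ratioSymbol d ξ := by
  unfold ratioSymbol; positivity

theorem one_sub_inv_eq_ratioSymbol {d : ℕ} (ξ : Euc d) :
    1 - 1 / (1 + (2 * Real.pi * ‖ξ‖) ^ 2) = ratioSymbol d ξ := by
  rw [ratioSymbol]
  have : 1 + (2 * Real.pi * ‖ξ‖) ^ 2 ≠ 0 := by positivity
  field_simp
  ring

theorem fourier_resolvent_iterate {d : ℕ} (ψ : 𝓢(Euc d, ℂ)) (k : ℕ) (ξ : Euc d) :
    𝓕 ((resolvent d)^[k] ψ : Euc d → ℂ) ξ =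
      (((1 / (1 + (2 * Real.pi * ‖ξ‖) ^ 2)) ^ k : ℝ) : ℂ) * 𝓕 (ψ : Euc d → ℂ) ξ := by
  induction k with
  | zero => simp
  | succ k ih =>
    rw [Function.iterate_succ_apply', fourier_resolvent, ih, pow_succ']
    push_cast
    ring

theorem eLpNorm_resolvent_iterate_le {d : ℕ} {p : ℝ} (hp : 1 ≤ p) (ψ : 𝓢(Euc d, ℂ)) (k : ℕ) :
    eLpNorm ((resolvent d)^[k] ψ) (ENNReal.ofReal p) volume ≤
      eLpNorm ψ (ENNReal.ofReal p) volume := by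
  induction k with
  | zero => simp
  | succ k ih =>
    rw [Function.iterate_succ_apply']
    exact (eLpNorm_resolvent_le hp _).trans ih

/-- `(Δ (I + Δ)⁻¹)^s ψ`. -/
def ratioOp {d : ℕ} (s : ℝ) (ψ : 𝓢(Euc d, ℂ)) : Euc d → ℂ :=
  𝓕⁻ fun ξ : Euc d => ((ratioSymbol d ξ ^ s : ℝ) : ℂ) * 𝓕 (ψ : Euc d → ℂ) ξ

theorem norm_char_smul {d : ℕ} (x ξ : Euc d) (w : ℂ) : ‖Real.fourierChar (inner ℝ ξ x) • w‖ = ‖w‖ :=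
  Circle.norm_smul _ _

/-- The expansion of (1-y)^s at y = 1/(1+λ), where 1 - y is `ratioSymbol`. It holds for ξ ≠ 0, where
y < 1, and may be integrated term by term because the coefficients are absolutely summable and |y| ≤
1. -/
theorem hasSum_ratioOp {d : ℕ} (hd : 1 ≤ d) {s : ℝ} (hs0 : 0 ≤ s) (hs1 : s ≤ 1)
    (ψ : 𝓢(Euc d, ℂ)) (x : Euc d) :
    HasSum (fun k => (binomCoeff s k : ℂ) * (resolvent d)^[k] ψ x) (ratioOp s ψ x) := by
  have : Nonempty (Fin d) := ⟨⟨0, hd⟩⟩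
  have hne : ∀ᵐ ξ : Euc d, ξ ≠ 0 := by simp [ae_iff]
  let F : ℕ → Euc d → ℂ := fun k ξ => (binomCoeff s k : ℂ) *
    (Real.fourierChar (inner ℝ ξ x) • 𝓕 ((resolvent d)^[k] ψ : Euc d → ℂ) ξ)
  have hF : ∀ k, F k = fun ξ => (binomCoeff s k : ℂ) *
      (Real.fourierChar (inner ℝ ξ x) • 𝓕 ((resolvent d)^[k] ψ : Euc d → ℂ) ξ) := fun k => rfl
  have hFi : ∀ k, Integrable (F k) := by
    intro k
    refine Integrable.const_mul ?_ _
    have := (Real.fourierIntegral_convergent_iff (-x)).2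
      ((𝓕 ((resolvent d)^[k] ψ)).integrable (μ := volume))
    simpa [SchwartzMap.fourier_coe] using this
  have hFn : ∀ k ξ, ‖F k ξ‖ ≤ |binomCoeff s k| * ‖𝓕 (ψ : Euc d → ℂ) ξ‖ := by
    intro k ξ
    rw [hF, norm_mul, Complex.norm_real, Real.norm_eq_abs, norm_char_smul,
      fourier_resolvent_iterate, norm_mul, Complex.norm_real, Real.norm_of_nonneg (by positivity)]
    gcongr
    refine mul_le_of_le_one_left (norm_nonneg _) (pow_le_one₀ (by positivity) ?_)
    rw [div_le_one (by positivity)]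
    nlinarith [sq_nonneg (2 * Real.pi * ‖ξ‖)]
  have hψi := ((𝓕 ψ).integrable (μ := volume)).norm
  have hsum : Summable fun k => ∫ ξ, ‖F k ξ‖ := by
    refine Summable.of_nonneg_of_le (fun k => integral_nonneg fun ξ => norm_nonneg _) (fun k => ?_)
      ((summable_abs_binomCoeff hs0 hs1).mul_right (∫ ξ, ‖𝓕 (ψ : Euc d → ℂ) ξ‖))
    rw [← integral_const_mul]
    exact integral_mono (hFi k).norm (hψi.const_mul _) (hFn k)
  have h := hasSum_integral_of_summable_integral_norm hFi hsum
  have e1 : ∀ k, ∫ ξ, F k ξ = (binomCoeff s k : ℂ) * (resolvent d)^[k] ψ x := by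
    intro k
    rw [hF, integral_const_mul, ← fourierInv_fourier_schwartz ((resolvent d)^[k] ψ) x,
      Real.fourierInv_eq]
  have e2 : ∫ ξ, ∑' k, F k ξ = ratioOp s ψ x := by
    rw [ratioOp, Real.fourierInv_eq]
    refine integral_congr_ae ?_
    filter_upwards [hne] with ξ hξ
    have hξ0 : 0 < (2 * Real.pi * ‖ξ‖) ^ 2 := by
      have := norm_pos_iff.2 hξ
      positivity
    have hb := hasSum_binomCoeff s (y := 1 / (1 + (2 * Real.pi * ‖ξ‖) ^ 2)) (by positivity)
      (by rw [div_lt_one (by positivity)]; linarith)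
    rw [one_sub_inv_eq_ratioSymbol] at hb
    have hb' := (Complex.hasSum_ofReal.2 hb).mul_right
      (Real.fourierChar (inner ℝ ξ x) • 𝓕 (ψ : Euc d → ℂ) ξ)
    rw [mul_smul_comm] at hb'
    refine Eq.trans ?_ hb'.tsum_eq
    refine tsum_congr fun k => ?_
    rw [hF]
    simp only [fourier_resolvent_iterate, Circle.smul_def, smul_eq_mul]
    push_cast
    ring
  rw [e2] at h
  simpa only [e1] using h

/-- Each power of the resolvent is a contraction and the coefficients have absolute sum at most 2.
The partial sums converge pointwise, so lower semicontinuity of the norm suffices. -/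
theorem eLpNorm_ratioOp_le_two {d : ℕ} (hd : 1 ≤ d) {s : ℝ} (hs0 : 0 ≤ s) (hs1 : s ≤ 1)
    {p : ℝ} (hp : 1 ≤ p) (ψ : 𝓢(Euc d, ℂ)) :
    eLpNorm (ratioOp s ψ) (ENNReal.ofReal p) volume ≤
      2 * eLpNorm ψ (ENNReal.ofReal p) volume := by
  have hc : ∀ k, Continuous fun x => (binomCoeff s k : ℂ) * (resolvent d)^[k] ψ x := fun k =>
    continuous_const.mul ((resolvent d)^[k] ψ).continuous
  refine Lp.eLpNorm_le_of_ae_tendsto (u := atTop)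
    (f := fun n => ∑ k ∈ Finset.range n, fun x => (binomCoeff s k : ℂ) * (resolvent d)^[k] ψ x)
    (Eventually.of_forall fun n => ?_) (fun n => ?_) (ae_of_all _ fun x => ?_)
  · calc eLpNorm (∑ k ∈ Finset.range n, fun x => (binomCoeff s k : ℂ) * (resolvent d)^[k] ψ x)
          (ENNReal.ofReal p) volume
        ≤ ∑ k ∈ Finset.range n, eLpNorm (fun x => (binomCoeff s k : ℂ) * (resolvent d)^[k] ψ x)
          (ENNReal.ofReal p) volume :=
          eLpNorm_sum_le (fun k _ => (hc k).aestronglyMeasurable) (ENNReal.one_le_ofReal.2 hp)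
      _ ≤ ∑ k ∈ Finset.range n, ENNReal.ofReal |binomCoeff s k| *
          eLpNorm ψ (ENNReal.ofReal p) volume := by
          refine Finset.sum_le_sum fun k _ => ?_
          refine (eLpNorm_const_smul (binomCoeff s k : ℂ) ((resolvent d)^[k] ψ : Euc d → ℂ)
            (ENNReal.ofReal p) volume).le.trans ?_
          gcongr
          · rw [← ofReal_norm, Complex.norm_real, Real.norm_eq_abs]
          · exact eLpNorm_resolvent_iterate_le hp ψ k
      _ = ENNReal.ofReal (∑ k ∈ Finset.range n, |binomCoeff s k|) *
          eLpNorm ψ (ENNReal.ofReal p) volume := by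
          rw [← Finset.sum_mul, ENNReal.ofReal_sum_of_nonneg fun k _ => abs_nonneg _]
      _ ≤ _ := by
          gcongr
          refine (ENNReal.ofReal_le_ofReal (sum_abs_binomCoeff_le hs0 hs1 n)).trans ?_
          simp
  · exact Finset.aestronglyMeasurable_sum _ fun k _ => (hc k).aestronglyMeasurable
  · simpa using (hasSum_ratioOp hd hs0 hs1 ψ x).tendsto_sum_nat

theorem eLpNorm_sub_resolvent_le {d : ℕ} {p : ℝ} (hp : 1 ≤ p) (ψ : 𝓢(Euc d, ℂ)) :
    eLpNorm (ψ - resolvent d ψ : 𝓢(Euc d, ℂ)) (ENNReal.ofReal p) volume ≤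
      2 * eLpNorm ψ (ENNReal.ofReal p) volume := by
  have h := eLpNorm_sub_le (μ := volume) ψ.continuous.aestronglyMeasurable
    (resolvent d ψ).continuous.aestronglyMeasurable (ENNReal.one_le_ofReal.2 hp)
  refine h.trans ?_
  rw [two_mul]
  gcongr
  exact eLpNorm_resolvent_le hp ψ

theorem ratioOp_add_one {d : ℕ} {s : ℝ} (hs : 0 ≤ s) (ψ : 𝓢(Euc d, ℂ)) :
    ratioOp (s + 1) ψ = ratioOp s (ψ - resolvent d ψ) := by
  rw [ratioOp, ratioOp]
  congr 1
  funext ξ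
  have e : 𝓕 ((ψ - resolvent d ψ : 𝓢(Euc d, ℂ)) : Euc d → ℂ) ξ =
      𝓕 (ψ : Euc d → ℂ) ξ - 𝓕 (resolvent d ψ : Euc d → ℂ) ξ := by
    rw [← SchwartzMap.fourier_coe, ← FourierTransform.fourierCLM_apply (R := ℂ), map_sub]
    rfl
  rw [e, fourier_resolvent, Real.rpow_add_one' (ratioSymbol_nonneg ξ) (by linarith),
    ← one_sub_inv_eq_ratioSymbol]
  push_cast
  ring

/-- For s > 1, factors I - R with R the resolvent, each of norm at most 2, are split off until the
exponent is at most 1. -/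
theorem eLpNorm_ratioOp_le {d : ℕ} (hd : 1 ≤ d) {p : ℝ} (hp : 1 ≤ p) (n : ℕ) {s : ℝ}
    (hs0 : 0 ≤ s) (hs1 : s ≤ n + 1) (ψ : 𝓢(Euc d, ℂ)) :
    eLpNorm (ratioOp s ψ) (ENNReal.ofReal p) volume ≤
      2 ^ (n + 1) * eLpNorm ψ (ENNReal.ofReal p) volume := by
  induction n generalizing s ψ with
  | zero =>
    rw [zero_add, pow_one]
    exact eLpNorm_ratioOp_le_two hd hs0 (by simpa using hs1) hp ψ
  | succ n ih =>
    rcases le_total s 1 with h | h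
    · refine (eLpNorm_ratioOp_le_two hd hs0 h hp ψ).trans ?_
      gcongr
      exact le_self_pow₀ one_le_two (by omega)
    · rw [← sub_add_cancel s 1, ratioOp_add_one (by linarith)]
      refine (ih (by linarith) (by push_cast at hs1; linarith) _).trans ?_
      rw [pow_succ _ (n + 1), mul_assoc]
      gcongr
      exact eLpNorm_sub_resolvent_le hp ψ

/-! ### The inhomogeneous space is contained in the homogeneous one -/

theorem besselSymbol_mul_neg (d : ℕ) (α : ℝ) :
    besselSymbol d α * besselSymbol d (-α) = fun _ => 1 := by
  funext ξ
  have h : 0 < 1 + (2 * Real.pi * ‖ξ‖) ^ 2 := by positivity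
  rw [Pi.mul_apply, besselSymbol, besselSymbol, ← Complex.ofReal_mul, ← Real.rpow_add h,
    neg_div, add_neg_cancel, Real.rpow_zero, Complex.ofReal_one]

theorem besselOp_neg_besselOp {d : ℕ} (α : ℝ) (T : 𝓢'(Euc d, ℂ)) :
    besselOp d (-α) (besselOp d α T) = T := by
  have h := TemperedDistribution.fourierMultiplierCLM_fourierMultiplierCLM_apply
    (F := ℂ) (besselSymbol_hasTemperateGrowth d α) (besselSymbol_hasTemperateGrowth d (-α)) T
  rw [besselSymbol_mul_neg, TemperedDistribution.fourierMultiplierCLM_const, one_smul] at h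
  exact h

theorem rpow_mul_besselSymbol {d : ℕ} (α : ℝ) (ξ : Euc d) :
    (((2 * Real.pi * ‖ξ‖) ^ α : ℝ) : ℂ) * besselSymbol d (-α) ξ =
      ((ratioSymbol d ξ ^ (α / 2) : ℝ) : ℂ) := by
  have h0 : 0 ≤ 2 * Real.pi * ‖ξ‖ := by positivity
  have h1 : 0 ≤ 1 + (2 * Real.pi * ‖ξ‖) ^ 2 := by positivity
  rw [besselSymbol, ← Complex.ofReal_mul, ratioSymbol, Real.div_rpow (by positivity) h1, neg_div,
    Real.rpow_neg h1, ← div_eq_mul_inv, ← Real.rpow_natCast, ← Real.rpow_mul h0]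
  congr 3
  push_cast
  ring

/-- This turns the comparison of the two Sobolev norms into an L^p bound for a function of the
resolvent. -/
theorem fracLaplacian_besselPotential {d : ℕ} (α : ℝ) (ψ : 𝓢(Euc d, ℂ)) :
    fracLaplacian α (SchwartzMap.fourierMultiplierCLM ℂ (besselSymbol d (-α)) ψ) =
      ratioOp (α / 2) ψ := by
  rw [fracLaplacian, ratioOp]
  congr 1
  funext ξ
  rw [fourier_fourierMultiplierCLM (besselSymbol_hasTemperateGrowth d _), ← mul_assoc,
    rpow_mul_besselSymbol]

theorem exists_schwartz_tendsto_eLpNorm {d : ℕ} {r : ℝ≥0∞} (hr : 1 ≤ r) (hr' : r ≠ ⊤)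
    {g : Euc d → ℂ} (hg : MemLp g r) :
    ∃ ψ : ℕ → 𝓢(Euc d, ℂ), Tendsto (fun n => eLpNorm ((ψ n : Euc d → ℂ) - g) r) atTop (𝓝 0) := by
  have : Fact (1 ≤ r) := ⟨hr⟩
  have hdense := SchwartzMap.denseRange_toLpCLM (E := Euc d) (F := ℂ) hr' (μ := volume)
  obtain ⟨u, hu, hlim⟩ := mem_closure_iff_seq_limit.1 (hdense (hg.toLp g))
  choose ψ hψ using hu
  refine ⟨ψ, ?_⟩
  rw [Lp.tendsto_Lp_iff_tendsto_eLpNorm'] at hlim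
  refine hlim.congr fun n => eLpNorm_congr_ae ?_
  have hn : u n = (ψ n).toLp r volume := (hψ n).symm
  filter_upwards [hg.coeFn_toLp, (ψ n).coeFn_toLp r volume] with x hx hy
  rw [Pi.sub_apply, Pi.sub_apply, hx, hn, hy]

/-- Every element of `L^p_α` belongs to the homogeneous space, with comparable norm. -/
theorem exists_homSobolevNorm {d : ℕ} {p q α : ℝ} (he : Exponents d p q α) {T : 𝓢'(Euc d, ℂ)}
    {N : ℝ≥0∞} (hT : InhomSobolevNorm p α T N) :
    ∃ N', HomSobolevNorm p α T N' ∧ N' ≤ 2 ^ (d + 1) * N := by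
  obtain ⟨K, hK⟩ : ∃ K : ℝ≥0∞, K = 2 ^ (d + 1) := ⟨_, rfl⟩
  have hKT : K ≠ ⊤ := hK ▸ ENNReal.pow_ne_top ENNReal.ofNat_ne_top
  rw [← hK]
  obtain ⟨-, g, -, -, hg, hTg, rfl⟩ := hT
  have hp := he.one_le_ofReal_p
  have hα := he.nonneg_order
  obtain ⟨ψ, hψ⟩ := exists_schwartz_tendsto_eLpNorm hp ENNReal.ofReal_ne_top hg
  set φ : ℕ → 𝓢(Euc d, ℂ) := fun n =>
    SchwartzMap.fourierMultiplierCLM ℂ (besselSymbol d (-α)) (ψ n) with hφ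
  have hfrac : ∀ n, fracLaplacian α (φ n) = ratioOp (α / 2) (ψ n) :=
    fun n => fracLaplacian_besselPotential α (ψ n)
  -- A crude bound from α < d; it makes the number of factors, hence the constant 2^{d+1}, depend on
  -- d alone.
  have hα2 : α / 2 ≤ (d : ℝ) + 1 := by linarith [he.order_lt_dim, he.dim_pos]
  have hratio : ∀ η : 𝓢(Euc d, ℂ), eLpNorm (ratioOp (α / 2) η) (ENNReal.ofReal p) volume ≤
      K * eLpNorm η (ENNReal.ofReal p) volume :=
    fun η => hK ▸ eLpNorm_ratioOp_le he.one_le_dim he.one_lt_p.le d (by linarith) hα2 η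
  have hmem : ∀ n, MemLp (fracLaplacian α (φ n)) (ENNReal.ofReal p) volume := fun n => by
    refine ⟨(continuous_fracLaplacian hα (φ n)).aestronglyMeasurable, ?_⟩
    rw [hfrac]
    exact (hratio (ψ n)).trans_lt
      (ENNReal.mul_lt_top hKT.lt_top ((ψ n).memLp _ _).2)
  have hcau : ∀ n m, eLpNorm (fracLaplacian α (φ n) - fracLaplacian α (φ m))
      (ENNReal.ofReal p) volume ≤ K *
      (eLpNorm ((ψ n : Euc d → ℂ) - g) (ENNReal.ofReal p) volume +
        eLpNorm ((ψ m : Euc d → ℂ) - g) (ENNReal.ofReal p) volume) := by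
    intro n m
    rw [← fracLaplacian_sub hα, hφ, ← map_sub, fracLaplacian_besselPotential]
    refine (hratio (ψ n - ψ m)).trans ?_
    gcongr
    have h := eLpNorm_sub_le (((ψ n).continuous.aestronglyMeasurable (μ := volume)).sub hg.1)
      (((ψ m).continuous.aestronglyMeasurable (μ := volume)).sub hg.1) hp
    rwa [sub_sub_sub_cancel_right] at h
  obtain ⟨g', hg', hlim⟩ := exists_memLp_tendsto_of_cauchy hp hmem
    hKT hψ hcau
  -- ψ n tends to (I+Δ)^{α/2} T as distributions, and the continuous operator (I+Δ)^{-α/2} carries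
  -- this to φ n → T.
  obtain ⟨S, hS, hψS⟩ := tendsto_toTemperedDistribution hp hg hψ
  rw [represents_unique hS hTg] at hψS
  have hφT : Tendsto (fun n => SchwartzMap.toTemperedDistributionCLM (Euc d) ℂ volume (φ n))
      atTop (𝓝 T) := by
    have h := ((besselOp d (-α)).continuous.tendsto (besselOp d α T)).comp hψS
    rw [besselOp_neg_besselOp] at h
    refine h.congr fun n => ?_
    exact TemperedDistribution.fourierMultiplierCLM_toTemperedDistributionCLM_eq
      (besselSymbol_hasTemperateGrowth d (-α)) (ψ n)
  refine ⟨eLpNorm g' (ENNReal.ofReal p) volume, ⟨φ, g', hg', hφT, hlim, rfl⟩, ?_⟩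
  have hb : Tendsto (fun n => K *
      (eLpNorm ((ψ n : Euc d → ℂ) - g) (ENNReal.ofReal p) volume +
        eLpNorm g (ENNReal.ofReal p) volume)) atTop
      (𝓝 (K * (0 + eLpNorm g (ENNReal.ofReal p) volume))) :=
    ENNReal.Tendsto.const_mul (hψ.add tendsto_const_nhds)
      (Or.inr hKT)
  rw [zero_add] at hb
  refine eLpNorm_le_of_tendsto hp (fun n => (hmem n).1) hg'.1 hlim hb fun n => ?_
  have htri := eLpNorm_add_le (((ψ n).continuous.aestronglyMeasurable (μ := volume)).sub hg.1)
    hg.1 hp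
  rw [sub_add_cancel] at htri
  rw [hfrac]
  exact (hratio (ψ n)).trans (mul_le_mul_right htri _)

/-- Each constant `C` admissible for the homogeneous embedding gives the admissible constant 2^{d+1}
C for the inhomogeneous one; dividing by 2^{d+1} allows the infimum over `C` to be taken. -/
theorem E_le_EH {d : ℕ} {p q α : ℝ} (he : Exponents d p q α) :
    E p q d ≤ 2 ^ (d + 1) * EH p q d := by
  have h0 : (2 : ℝ≥0∞) ^ (d + 1) ≠ 0 := by positivity
  have hT : (2 : ℝ≥0∞) ^ (d + 1) ≠ ⊤ := ENNReal.pow_ne_top ENNReal.ofNat_ne_top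
  rw [mul_comm, ← ENNReal.div_le_iff h0 hT]
  refine le_sInf fun C hC => ?_
  rw [ENNReal.div_le_iff h0 hT]
  refine sInf_le fun T N hN => ?_
  rw [he.order_eq] at hN hC
  obtain ⟨N', hN', hle⟩ := exists_homSobolevNorm he hN
  obtain ⟨f, hf, hTf, hfle⟩ := hC T N' hN'
  refine ⟨f, hf, hTf, hfle.trans ?_⟩
  rw [mul_assoc]
  gcongr

end SobolevConst

end

theorem proposition4p1 (d : ℕ) (hd : 1 ≤ d) :
    ∃ B₁ B₂ : ℝ, 0 < B₁ ∧ 0 < B₂ ∧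
      ∀ p q α : ℝ, 1 < p → 0 ≤ α → α < d / p → p ≤ q → 1 / q = 1 / p - α / d →
        SobolevConst.E p q d ≤ ENNReal.ofReal B₁ * SobolevConst.EH p q d ∧
        ENNReal.ofReal B₁ * SobolevConst.EH p q d
          ≤ ENNReal.ofReal (B₁ * SobolevConst.EHtilde p q d) ∧
        1 / B₂ * SobolevConst.F p q ≤ SobolevConst.EHtilde p q d ∧
        SobolevConst.EHtilde p q d ≤ B₂ * SobolevConst.F p q := by
  obtain ⟨B₂, hB₂, hF⟩ := SobolevConst.exists_EHtilde_bounds d hd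
  -- `B₁` is the L^p bound for the multiplier (Δ(I+Δ)⁻¹)^{α/2}.
  refine ⟨2 ^ (d + 1), B₂, by positivity, hB₂, fun p q α hp hα hαd hpq hq => ?_⟩
  have he : SobolevConst.Exponents d p q α := ⟨hd, hp, hα, hαd, hpq, hq⟩
  have h2 : ENNReal.ofReal (2 ^ (d + 1)) = 2 ^ (d + 1) := by
    rw [ENNReal.ofReal_pow (by norm_num), ENNReal.ofReal_ofNat]
  refine ⟨?_, ?_, hF p q α he⟩
  · rw [h2]
    exact SobolevConst.E_le_EH he
  · rw [ENNReal.ofReal_mul (by positivity)]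
    gcongr
    exact SobolevConst.EH_le_EHtilde he
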